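/- Let $V$ be a set of $n$ vertices and let $G_0=(V,E_0)$ be an oriented graph, whose edges are initially occupied. Each oriented edge $i\to j$ with $i\neq j$ and $i\to j\notin E_0$ is, independently of the others, open with probability $p_{\rm open}$; let $E_{\rm open}$ be the random set of open edges. For $t\ge 0$ put $$E_{t+1}=E_t\cup\{\,i\to j\in E_{\rm open}:\ i\to k\in E_t \text{ and } k\to j\in E_t\text{ for some }k\in V\,\},\qquad E_\infty=\bigcup_{t\ge0}E_t .$$ Saturation is the event that $E_{\rm open}\subseteq E_\infty$, i.e. every open edge is eventually occupied. For an integer $R\ge1$, call $G_0$ *$R$-unoriented* if there are an (unoriented) tree $T$ on a vertex set $V'$ and a map $\phi:V\to V'$ such that (1) for every $y\in V'$, $|\phi^{-1}(y)|\le R$ and the subgraph of $G_0$ induced by $\phi^{-1}(y)$ is (nonempty and) strongly connected; and (2) for every ordered pair $(y_1,y_2)$ of neighbours in $T$ there are $x_1\in\phi^{-1}(y_1)$ and $x_2\in\phi^{-1}(y_2)$ with $x_1\to x_2\in E_0$. **Theorem.** For every integer $R\ge1$ there is a constant $C_0=C_0(R)$ such that the following holds for every constant $C\ge C_0$. If,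 for all large $n$, $G_0=G_0^{(n)}$ is an $R$-unoriented graph on $n$ vertices and $p_{\rm open}=p_{\rm open}(n)\in[0,1]$ satisfies $$p_{\rm open}\ \ge\ C\,\frac{\log\log n}{\sqrt{\log n}},$$ then the probability of saturation tends to $1$ as $n\to\infty$. -/

import Mathlib

open Filter Topology MeasureTheory ProbabilityTheory

namespace TransClosure

universe u

variable {V : Type u}

/-- The set of oriented edges of an oriented graph; `(i, j)` stands for `i → j`. -/
def edges (G₀ : Digraph V) : Set (V × V) := {e | G₀.Adj e.1 e.2}

/-- The set `E_t` of edges occupied by time `t`, when the initially occupied edges are those of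
`G₀` and the open edges are those in `Eopen`. -/
def occupied (G₀ : Digraph V) (Eopen : Set (V × V)) : ℕ → Set (V × V)
  | 0 => edges G₀
  | t + 1 => occupied G₀ Eopen t ∪
      {e | e ∈ Eopen ∧ ∃ k : V, (e.1, k) ∈ occupied G₀ Eopen t ∧ (k, e.2) ∈ occupied G₀ Eopen t}

/-- The set `E_∞` of eventually occupied edges. -/
def eventuallyOccupied (G₀ : Digraph V) (Eopen : Set (V × V)) : Set (V × V) :=
  ⋃ t : ℕ, occupied G₀ Eopen t

/-- The vertex set `S` is (eventually) saturated: every open edge in `S × S` is eventually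
occupied. -/
def IsSaturated (G₀ : Digraph V) (Eopen : Set (V × V)) (S : Set V) : Prop :=
  ∀ e ∈ Eopen, e ∈ S ×ˢ S → e ∈ eventuallyOccupied G₀ Eopen

/-- The edges that may be open: the oriented edges between distinct vertices that are not
initially occupied. -/
def candidateEdges (G₀ : Digraph V) : Set (V × V) := {e | e.1 ≠ e.2 ∧ e ∉ edges G₀}

/-- The law of the random set of open edges: every edge that may be open is open with
probability `p`, independently of all the others. -/
noncomputable def openLaw (G₀ : Digraph V) (p : unitInterval) : Measure (Set (V × V)) :=
  setBernoulli (candidateEdges G₀) p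

/-- The subgraph of `G₀` induced by `S` is strongly connected: `S` is nonempty, and from every
vertex of `S` to every other there is an oriented path in `G₀` all of whose vertices are in `S`. -/
def StronglyConnectedOn (G₀ : Digraph V) (S : Set V) : Prop :=
  S.Nonempty ∧ ∀ x ∈ S, ∀ y ∈ S,
    Relation.ReflTransGen (fun a b => a ∈ S ∧ b ∈ S ∧ G₀.Adj a b) x y

/-- `G₀` is `R`-unoriented: it is mapped by some `φ` onto the vertices of a tree `T` in such a way
that the fibres of `φ` have at most `R` vertices and are strongly connected, and that there is an
edge of `G₀` from the fibre over `y₁` to the fibre over `y₂` for every ordered pair of neighbours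
`y₁`, `y₂` in `T` (hence, by the symmetry of `T`, one in each direction). -/
def IsRUnoriented (R : ℕ) (G₀ : Digraph V) : Prop :=
  ∃ (V' : Type u) (T : SimpleGraph V') (φ : V → V'), T.IsTree ∧
    (∀ y : V', (φ ⁻¹' {y}).encard ≤ R ∧ StronglyConnectedOn G₀ (φ ⁻¹' {y})) ∧
    ∀ y₁ y₂ : V', T.Adj y₁ y₂ → ∃ x₁ x₂ : V, φ x₁ = y₁ ∧ φ x₂ = y₂ ∧ G₀.Adj x₁ x₂

end TransClosure

/-! Write X = log n and q = 36R log X / √X, a lower bound for the opening probability. Saturation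
comes from nucleation followed by growth.

Nucleation: a strongly connected block is filled as soon as all edges between one of its vertices
and the others are available (`StarIn.filled`). A block of between m and Rm vertices, m ≈ X/(8R log
X), has such a complete star with probability at least q^(2Rm) ≥ n^(-1/4). The tree yields at least
√n blocks with disjoint, hence independent, stars (`exists_centred_sets`).

Growth: a filled set S is enlarged by one fibre of the tree map at a time. If v is new and v → u is
initial, occupation passes from v → u to v → w along a path from u to w through out-neighbours of v
in S (`Spreads.mem`). There are about q|S| such out-neighbours, carrying a random digraph of density
q; a union bound over cuts shows that the path is missing with probability of order exp(-q²|S|/16)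
(`real_not_spreads_le`). As q²m ≥ 160 log X, summing over all sizes from m on gives O(X⁻²).

Nucleation and growth share edges, but failure of growth from a block is a decreasing event, hence
negatively correlated with completeness of its star (`IndepBits.real_superset_inter_le`). With a
subfamily of stars of which between X and X + 1 are complete on average, the failure probability is
at most e^(-X) + (X + 1)·O(X⁻²). -/

namespace TransClosure

/-! ### Deterministic nucleation and growth -/

section Deterministic

variable {V : Type*}

/-- `O ⊆ ω`, and `O` is closed under those transitive steps that are permitted by `ω`. -/
structure TransitiveWithin (O ω : Set (V × V)) : Prop where
  subset : O ⊆ ω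
  trans : ∀ a b c, (a, b) ∈ O → (b, c) ∈ O → (a, c) ∈ ω → (a, c) ∈ O
  loop : ∀ a, (a, a) ∈ ω → (a, a) ∈ O

/-- Invariance under edge reversal is what lets one growth argument serve for both outgoing and
incoming edges of the new vertices. -/
lemma TransitiveWithin.swap {O ω : Set (V × V)} (h : TransitiveWithin O ω) :
    TransitiveWithin (Prod.swap ⁻¹' O) (Prod.swap ⁻¹' ω) where
  subset := Set.preimage_mono h.subset
  trans := fun a b c hab hbc hac => h.trans c b a hbc hab hac
  loop := fun a ha => h.loop a ha

/-- There is an `ω`-path from `u` to `w` all of whose intermediate vertices are `ω`-out-neighbours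
of `v` in `S`. -/
def Spreads (S : Set V) (ω : Set (V × V)) (v u w : V) : Prop :=
  Relation.ReflTransGen (fun a b => (a, b) ∈ ω ∧ (b = w ∨ b ∈ S ∧ (v, b) ∈ ω)) u w

lemma Spreads.mono {S : Set V} {ω ω' : Set (V × V)} (h : ω ⊆ ω') {v u w : V}
    (hs : Spreads S ω v u w) : Spreads S ω' v u w :=
  Relation.ReflTransGen.mono (fun _ _ hab => ⟨h hab.1, hab.2.imp id fun hb => ⟨hb.1, h hb.2⟩⟩) _ _ hs

/-- All the edges from `S` to `W` in `ω` lie in `O`. -/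
def Filled (O ω : Set (V × V)) (S W : Set V) : Prop :=
  ∀ a ∈ S, ∀ b ∈ W, (a, b) ∈ ω → (a, b) ∈ O

/-- Occupation of v → a moves to v → b along each step a → b of the path, because a → b is already
occupied: a is u or lies in S. -/
lemma Spreads.mem {O ω : Set (V × V)} (h : TransitiveWithin O ω) {S W : Set V} (hSW : S ⊆ W)
    (hS : Filled O ω S W) {v u w : V} (hu : ∀ b ∈ W, (u, b) ∈ ω → (u, b) ∈ O) (hw : w ∈ W)
    (hvu : (v, u) ∈ O) (hvw : (v, w) ∈ ω) (hs : Spreads S ω v u w) : (v, w) ∈ O := by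
  -- The path may visit w, possibly outside S, before its end; the first alternative records that
  -- the goal is then already reached.
  have key : ∀ b, Relation.ReflTransGen (fun a b => (a, b) ∈ ω ∧ (b = w ∨ b ∈ S ∧ (v, b) ∈ ω)) u b →
      (v, w) ∈ O ∨ (v, b) ∈ O ∧ (b = u ∨ b ∈ S) := by
    intro b hb
    induction hb with
    | refl => exact Or.inr ⟨hvu, Or.inl rfl⟩
    | @tail a b _ hab ih =>
      rcases ih with ih | ⟨hva, ha⟩
      · exact Or.inl ih
      have hbW : b ∈ W := by
        rcases hab.2 with rfl | hb
        · exact hw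
        · exact hSW hb.1
      have habO : (a, b) ∈ O := by
        rcases ha with rfl | ha
        · exact hu b hbW hab.1
        · exact hS a ha b hbW hab.1
      rcases hab.2 with rfl | hb
      · exact Or.inl (h.trans _ _ _ hva habO hvw)
      · exact Or.inr ⟨h.trans _ _ _ hva habO hb.2, Or.inr hb.1⟩
  rcases key w hs with h | h
  · exact h
  · exact h.1

/-- Every vertex of `T` outside `S` can spread within `S` towards all of `T`. -/
def SpreadsOut (S T : Set V) (ω : Set (V × V)) : Prop :=
  ∀ v ∈ T \ S, ∀ u ∈ T, ∀ w ∈ T, u ≠ v → w ≠ v → u ≠ w → Spreads S ω v u w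

/-- Induction along an occupied path from v to S, starting at the S end: when v is treated, its
successor u is already filled towards W, so spreading from v → u applies. -/
lemma Filled.grow {O ω : Set (V × V)} (h : TransitiveWithin O ω) {S T W : Set V} (hSW : S ⊆ W)
    (hWT : W ⊆ T) {r : V → V → Prop} (hr : ∀ a b, r a b → (a, b) ∈ O)
    (hpath : ∀ v ∈ T, ∃ s ∈ S, Relation.ReflTransGen (fun a b => a ∈ T ∧ b ∈ T ∧ r a b) v s)
    (hS : Filled O ω S W) (hgood : SpreadsOut S T ω) : Filled O ω T W := by
  intro v hv
  obtain ⟨s, hs, hvs⟩ := hpath v hv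
  clear hv
  induction hvs using Relation.ReflTransGen.head_induction_on with
  | refl => exact hS s hs
  | @head v u hvu _ ih =>
    intro w hw hvw
    by_cases hvS : v ∈ S
    · exact hS v hvS w hw hvw
    by_cases h1 : u = v
    · subst h1
      exact ih w hw hvw
    by_cases h2 : w = v
    · subst h2
      exact h.loop _ hvw
    by_cases h3 : u = w
    · subst h3
      exact hr _ _ hvu.2.2
    exact (hgood v ⟨hvu.1, hvS⟩ u hvu.2.1 w (hWT hw) h1 h2 h3).mem h hSW hS ih hw
      (hr _ _ hvu.2.2) hvw

lemma filled_swap {O ω : Set (V × V)} {S W : Set V} :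
    Filled (Prod.swap ⁻¹' O) (Prod.swap ⁻¹' ω) S W ↔ Filled O ω W S :=
  ⟨fun h a ha b hb => h b hb a ha, fun h a ha b hb => h b hb a ha⟩

lemma reflTransGen_flip {r : V → V → Prop} {T : Set V} {a b : V}
    (h : Relation.ReflTransGen (fun a b => a ∈ T ∧ b ∈ T ∧ r a b) a b) :
    Relation.ReflTransGen (fun a b => a ∈ T ∧ b ∈ T ∧ r b a) b a :=
  Relation.ReflTransGen.mono (fun _ _ h => ⟨h.2.1, h.1, h.2.2⟩) _ _ h.swap

/-- Two applications of `Filled.grow`: in the reversed graph it fills the edges from S to T, and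
this is the hypothesis needed to fill those from T to T. -/
lemma Filled.step {G₀ : Digraph V} {O ω : Set (V × V)} (h : TransitiveWithin O ω)
    (hG : edges G₀ ⊆ O) {S T : Set V} (hST : S ⊆ T) (hne : S.Nonempty)
    (hT : StronglyConnectedOn G₀ T) (h1 : SpreadsOut S T ω)
    (h2 : SpreadsOut S T (Prod.swap ⁻¹' ω)) (hS : Filled O ω S S) : Filled O ω T T := by
  obtain ⟨s, hs⟩ := hne
  have hout : ∀ v ∈ T, ∃ s ∈ S,
      Relation.ReflTransGen (fun a b => a ∈ T ∧ b ∈ T ∧ G₀.Adj a b) v s :=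
    fun v hv => ⟨s, hs, hT.2 v hv s (hST hs)⟩
  have hin : ∀ v ∈ T, ∃ s ∈ S,
      Relation.ReflTransGen (fun a b => a ∈ T ∧ b ∈ T ∧ G₀.Adj b a) v s :=
    fun v hv => ⟨s, hs, reflTransGen_flip (hT.2 s (hST hs) v hv)⟩
  have hST' : Filled O ω S T := filled_swap.1 <|
    Filled.grow h.swap subset_rfl hST (fun a b hab => hG hab) hin (filled_swap.2 hS) h2
  exact Filled.grow h hST subset_rfl (fun a b hab => hG hab) hout hST' h1

/-- All edges between `o` and the other vertices of `S` belong to `ω`. -/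
def StarIn (S : Set V) (o : V) (ω : Set (V × V)) : Prop :=
  ∀ x ∈ S, x ≠ o → (o, x) ∈ ω ∧ (x, o) ∈ ω

/-- Along initial paths from o, the step from o → a and a → b to o → b is permitted by the star;
dually for paths into o. Every other edge then has o as its intermediate vertex. -/
lemma StarIn.filled {G₀ : Digraph V} {O ω : Set (V × V)} (h : TransitiveWithin O ω)
    (hG : edges G₀ ⊆ O) {S : Set V} (hS : StronglyConnectedOn G₀ S) {o : V} (ho : o ∈ S)
    (hstar : StarIn S o ω) : Filled O ω S S := by
  have hout : ∀ x ∈ S, x = o ∨ (o, x) ∈ O := by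
    intro x hx
    have := hS.2 o ho x hx
    clear hx
    induction this with
    | refl => exact Or.inl rfl
    | @tail a b _ hab ih =>
      by_cases hb : b = o
      · exact Or.inl hb
      rcases ih with rfl | ih
      · exact Or.inr (hG hab.2.2)
      · exact Or.inr (h.trans _ _ _ ih (hG hab.2.2) (hstar b hab.2.1 hb).1)
  have hin : ∀ x ∈ S, x = o ∨ (x, o) ∈ O := by
    intro x hx
    have := hS.2 x hx o ho
    clear hx
    induction this using Relation.ReflTransGen.head_induction_on with
    | refl => exact Or.inl rfl
    | @head a b hab _ ih =>
      by_cases ha : a = o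
      · exact Or.inl ha
      rcases ih with rfl | ih
      · exact Or.inr (hG hab.2.2)
      · exact Or.inr (h.trans _ _ _ (hG hab.2.2) ih (hstar a hab.1 ha).2)
  intro a ha b hb hab
  rcases hin a ha with rfl | ha'
  · rcases hout b hb with rfl | hb'
    · exact h.loop _ hab
    · exact hb'
  · rcases hout b hb with rfl | hb'
    · exact ha'
    · exact h.trans _ _ _ ha' hb' hab

lemma occupied_mono (G₀ : Digraph V) (E : Set (V × V)) : Monotone (occupied G₀ E) :=
  monotone_nat_of_le_succ fun _ => Set.subset_union_left

lemma occupied_subset (G₀ : Digraph V) (E : Set (V × V)) (t : ℕ) :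
    occupied G₀ E t ⊆ edges G₀ ∪ E := by
  induction t with
  | zero => exact Set.subset_union_left
  | succ t ih => exact Set.union_subset ih fun e he => Or.inr he.1

lemma edges_subset_eventuallyOccupied (G₀ : Digraph V) (E : Set (V × V)) :
    edges G₀ ⊆ eventuallyOccupied G₀ E :=
  Set.subset_iUnion (occupied G₀ E) 0

lemma transitiveWithin_eventuallyOccupied (G₀ : Digraph V) {E : Set (V × V)}
    (hE : E ⊆ candidateEdges G₀) :
    TransitiveWithin (eventuallyOccupied G₀ E) (edges G₀ ∪ E) where
  subset := Set.iUnion_subset (occupied_subset G₀ E)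
  trans := by
    intro a b c hab hbc hac
    rcases hac with hac | hac
    · exact edges_subset_eventuallyOccupied G₀ E hac
    obtain ⟨s, hs⟩ := Set.mem_iUnion.1 hab
    obtain ⟨t, ht⟩ := Set.mem_iUnion.1 hbc
    exact Set.mem_iUnion.2 ⟨max s t + 1, Or.inr ⟨hac, b,
      occupied_mono G₀ E (le_max_left s t) hs, occupied_mono G₀ E (le_max_right s t) ht⟩⟩
  loop := by
    intro a ha
    rcases ha with ha | ha
    · exact edges_subset_eventuallyOccupied G₀ E ha
    · exact absurd rfl (hE ha).1

lemma isSaturated_of_filled {G₀ : Digraph V} {E : Set (V × V)}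
    (h : Filled (eventuallyOccupied G₀ E) (edges G₀ ∪ E) Set.univ Set.univ) :
    IsSaturated G₀ E Set.univ :=
  fun e he _ => h e.1 trivial e.2 trivial (Or.inr he)

end Deterministic

/-! ### Connected blocks from the tree structure -/

section Blocks

lemma StronglyConnectedOn.exists_exit {V : Type*} {H : Digraph V} {P B : Set V}
    (hP : StronglyConnectedOn H P) {b p : V} (hb : b ∈ B) (hbP : b ∈ P) (hp : p ∈ P) (hpB : p ∉ B) :
    ∃ a ∈ B, ∃ c ∈ P, c ∉ B ∧ H.Adj a c := by
  by_contra! hcon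
  have := hP.2 b hbP p hp
  refine hpB ?_
  clear hp hpB
  induction this with
  | refl => exact hb
  | @tail x y _ hxy ih =>
    by_contra hy
    exact hcon x ih y hxy.2.1 hy hxy.2.2

lemma stronglyConnectedOn_singleton {V : Type*} (H : Digraph V) (a : V) :
    StronglyConnectedOn H {a} := by
  refine ⟨⟨a, rfl⟩, ?_⟩
  rintro x rfl y rfl
  exact .refl

lemma StronglyConnectedOn.insert {V : Type*} {H : Digraph V} {Y : Set V}
    (hY : StronglyConnectedOn H Y) {a c : V} (ha : a ∈ Y) (hac : H.Adj a c) (hca : H.Adj c a) :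
    StronglyConnectedOn H (insert c Y) := by
  have hmono : ∀ x ∈ Y, ∀ y ∈ Y, Relation.ReflTransGen
      (fun a b => a ∈ Insert.insert c Y ∧ b ∈ Insert.insert c Y ∧ H.Adj a b) x y :=
    fun x hx y hy => Relation.ReflTransGen.mono
      (fun _ _ h => ⟨Or.inr h.1, Or.inr h.2.1, h.2.2⟩) _ _ (hY.2 x hx y hy)
  refine ⟨⟨c, Or.inl rfl⟩, ?_⟩
  rintro x (rfl | hx) y (rfl | hy)
  · exact .refl
  · exact .head ⟨Or.inl rfl, Or.inr ha, hca⟩ (hmono a ha y hy)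
  · exact .tail (hmono x hx a ha) ⟨Or.inr ha, Or.inl rfl, hac⟩
  · exact hmono x hx y hy

variable {W : Type*} {T : SimpleGraph W}

lemma exists_insert_stronglyConnectedOn {P Y : Set W} (hP : StronglyConnectedOn ⟨T.Adj⟩ P)
    (hY : StronglyConnectedOn ⟨T.Adj⟩ Y) (hYP : Y ⊆ P) (hne : Y ≠ P) :
    ∃ c ∈ P, c ∉ Y ∧ (∃ a ∈ Y, T.Adj a c) ∧ StronglyConnectedOn ⟨T.Adj⟩ (insert c Y) := by
  obtain ⟨b, hb⟩ := hY.1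
  obtain ⟨p, hp, hpY⟩ := Set.exists_of_ssubset (hYP.ssubset_of_ne hne)
  obtain ⟨a, ha, c, hc, hcY, hac⟩ := hP.exists_exit hb (hYP hb) hp hpY
  exact ⟨c, hc, hcY, ⟨a, ha, hac⟩, hY.insert ha hac hac.symm⟩

lemma exists_stronglyConnectedOn_ncard_eq [Finite W] {P : Set W} (hP : StronglyConnectedOn ⟨T.Adj⟩ P) {y : W}
    (hy : y ∈ P) {m : ℕ} (hm : 1 ≤ m) (hmP : m ≤ P.ncard) :
    ∃ B ⊆ P, y ∈ B ∧ StronglyConnectedOn ⟨T.Adj⟩ B ∧ B.ncard = m := by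
  induction m, hm using Nat.le_induction with
  | base => exact ⟨{y}, by simpa using hy, rfl, stronglyConnectedOn_singleton _ _, by simp⟩
  | succ m _ ih =>
    obtain ⟨B, hBP, hyB, hB, hcard⟩ := ih (by omega)
    obtain ⟨c, hc, hcB, _, hB'⟩ := exists_insert_stronglyConnectedOn hP hB hBP
      (by rintro rfl; omega)
    exact ⟨insert c B, Set.insert_subset hc hBP, Or.inr hyB, hB', by
      rw [Set.ncard_insert_of_notMem hcB, hcard]⟩

/-- A connected graph carries connected sets `B y` of size `m`, all but few of its vertices `y`
being centres, such that no two centres belong to each other's sets. -/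
lemma exists_centred_sets [Finite W] (hT : StronglyConnectedOn ⟨T.Adj⟩ (Set.univ : Set W)) {m : ℕ}
    (hm : 1 ≤ m) {k : ℕ} (hmk : m ≤ k) (hk : k ≤ Nat.card W) :
    ∃ (Y : Set W) (I : Finset W) (B : W → Set W), StronglyConnectedOn ⟨T.Adj⟩ Y ∧ Y.ncard = k ∧
      (I : Set W) ⊆ Y ∧ I.card + m = k ∧
      (∀ y ∈ I, y ∈ B y ∧ B y ⊆ Y ∧ StronglyConnectedOn ⟨T.Adj⟩ (B y) ∧ (B y).ncard = m) ∧
      ∀ y ∈ I, ∀ z ∈ I, y ∈ B z → z ∈ B y → y = z := by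
  classical
  induction k, hmk using Nat.le_induction with
  | base =>
    obtain ⟨y, hy⟩ := hT.1
    obtain ⟨B, -, -, hB, hcard⟩ := exists_stronglyConnectedOn_ncard_eq hT hy hm
      (by rwa [Set.ncard_univ])
    exact ⟨B, ∅, fun _ => ∅, hB, hcard, by simp, by simp, by simp, by simp⟩
  | succ k hmk ih =>
    obtain ⟨Y, I, B, hY, hYk, hIY, hI, hB, hdisj⟩ := ih (by omega)
    obtain ⟨c, -, hcY, -, hY'⟩ := exists_insert_stronglyConnectedOn hT hY (Set.subset_univ _)
      (by rintro rfl; rw [Set.ncard_univ] at hYk; omega)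
    have hcard' : (insert c Y).ncard = k + 1 := by rw [Set.ncard_insert_of_notMem hcY, hYk]
    -- D may overlap the earlier sets, but these lie in Y and so miss the new centre c: no two
    -- centres can belong to each other's sets.
    obtain ⟨D, hDY, hcD, hD, hDm⟩ := exists_stronglyConnectedOn_ncard_eq hY'
      (Set.mem_insert c Y) hm (by omega)
    have hcI : c ∉ I := fun h => hcY (hIY h)
    have hBne : ∀ y ∈ I, Function.update B c D y = B y := fun y hy =>
      Function.update_of_ne (by rintro rfl; exact hcI hy) _ _
    refine ⟨insert c Y, insert c I, Function.update B c D, hY', hcard', ?_, ?_, ?_, ?_⟩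
    · rw [Finset.coe_insert]
      exact Set.insert_subset_insert hIY
    · rw [Finset.card_insert_of_notMem hcI]
      omega
    · intro y hy
      rcases Finset.mem_insert.1 hy with rfl | hy
      · simpa using ⟨hcD, hDY, hD, hDm⟩
      · rw [hBne y hy]
        obtain ⟨h1, h2, h3⟩ := hB y hy
        exact ⟨h1, h2.trans (Set.subset_insert _ _), h3⟩
    · intro y hy z hz hyz hzy
      rcases Finset.mem_insert.1 hy with rfl | hy' <;> rcases Finset.mem_insert.1 hz with rfl | hz'
      · rfl
      · rw [hBne z hz'] at hyz
        exact absurd ((hB z hz').2.1 hyz) hcY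
      · rw [hBne y hy'] at hzy
        exact absurd ((hB y hy').2.1 hzy) hcY
      · rw [hBne z hz'] at hyz
        rw [hBne y hy'] at hzy
        exact hdisj y hy' z hz' hyz hzy

/-- A walk in Y lifts: cross between fibres by the given edges, and join arrival to departure points
inside each strongly connected fibre. -/
lemma stronglyConnectedOn_preimage {V : Type*} {G₀ : Digraph V} {φ : V → W}
    (hfib : ∀ y, StronglyConnectedOn G₀ (φ ⁻¹' {y}))
    (hedge : ∀ y₁ y₂, T.Adj y₁ y₂ → ∃ x₁ x₂, φ x₁ = y₁ ∧ φ x₂ = y₂ ∧ G₀.Adj x₁ x₂) {Y : Set W}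
    (hY : StronglyConnectedOn ⟨T.Adj⟩ Y) : StronglyConnectedOn G₀ (φ ⁻¹' Y) := by
  have hmono : ∀ y ∈ Y, ∀ a b, φ a = y → φ b = y → Relation.ReflTransGen
      (fun a b => a ∈ φ ⁻¹' Y ∧ b ∈ φ ⁻¹' Y ∧ G₀.Adj a b) a b := by
    intro y hy a b ha hb
    refine Relation.ReflTransGen.mono (fun c d h => ⟨?_, ?_, h.2.2⟩) _ _ ((hfib y).2 a ha b hb)
    · rw [Set.mem_preimage, show φ c = y from h.1]; exact hy
    · rw [Set.mem_preimage, show φ d = y from h.2.1]; exact hy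
  refine ⟨?_, ?_⟩
  · obtain ⟨y, hy⟩ := hY.1
    obtain ⟨x, hx⟩ := (hfib y).1
    exact ⟨x, by rw [Set.mem_preimage, show φ x = y from hx]; exact hy⟩
  · intro x hx z hz
    have := hY.2 (φ x) hx (φ z) hz
    have key : ∀ b, Relation.ReflTransGen (fun a b => a ∈ Y ∧ b ∈ Y ∧ T.Adj a b) (φ x) b →
        ∀ z, φ z = b → Relation.ReflTransGen
          (fun a b => a ∈ φ ⁻¹' Y ∧ b ∈ φ ⁻¹' Y ∧ G₀.Adj a b) x z := by
      intro b hb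
      induction hb with
      | refl => exact fun z hz => hmono _ hx x z rfl hz
      | @tail b c _ hbc ih =>
        intro z hz
        obtain ⟨x₁, x₂, h1, h2, h⟩ := hedge b c hbc.2.2
        refine ((ih x₁ h1).tail ⟨?_, ?_, h⟩).trans (hmono c hbc.2.1 x₂ z h2 hz)
        · rw [Set.mem_preimage, h1]; exact hbc.1
        · rw [Set.mem_preimage, h2]; exact hbc.2.1
    exact key _ this z rfl

lemma ncard_preimage_le [Finite W] {V : Type*} [Finite V] {φ : V → W} {R : ℕ}
    (hR : ∀ y, (φ ⁻¹' {y}).ncard ≤ R) (Y : Set W) : (φ ⁻¹' Y).ncard ≤ R * Y.ncard := by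
  induction Y, Y.toFinite using Set.Finite.induction_on with
  | empty => simp
  | @insert a s ha _ ih =>
    rw [Set.ncard_insert_of_notMem ha, Set.insert_eq, Set.preimage_union]
    calc _ ≤ _ := Set.ncard_union_le _ _
      _ ≤ R + R * s.ncard := add_le_add (hR a) ih
      _ = _ := by ring

lemma ncard_le_ncard_preimage {V : Type*} [Finite V] {φ : V → W} (hφ : φ.Surjective) (Y : Set W) :
    Y.ncard ≤ (φ ⁻¹' Y).ncard := by
  conv_lhs => rw [← Set.image_preimage_eq Y hφ]
  exact Set.ncard_image_le

end Blocks

/-- A tree-like graph is exhausted by strongly connected sets that grow by at most `R` vertices at a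
time, and it has many starting sets `B o` of moderate size with pairwise disjoint stars between
their centres `o` and their other vertices. -/
lemma IsRUnoriented.exists_blocks {V : Type*} [Finite V] {R : ℕ} {G₀ : Digraph V}
    (h : IsRUnoriented R G₀) {m : ℕ} (hm : 1 ≤ m) :
    ∃ (F : Set (Set V)) (I : Finset V) (B : V → Set V),
      (∀ S ∈ F, StronglyConnectedOn G₀ S) ∧
      (∀ S ∈ F, S ≠ Set.univ → ∃ T ∈ F, S ⊂ T ∧ (T \ S).ncard ≤ R) ∧
      Nat.card V ≤ R * (I.card + m) ∧
      (∀ o ∈ I, o ∈ B o ∧ B o ∈ F ∧ m ≤ (B o).ncard ∧ (B o).ncard ≤ R * m) ∧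
      ∀ o ∈ I, ∀ o' ∈ I, o ∈ B o' → o' ∈ B o → o = o' := by
  classical
  obtain ⟨W, T, φ, hT, hfib, hedge⟩ := h
  have hfib' := fun y => (hfib y).2
  have hR : ∀ y, (φ ⁻¹' {y}).ncard ≤ R := fun y => by
    have := (hfib y).1
    rw [← (Set.toFinite _).cast_ncard_eq] at this
    exact_mod_cast this
  have hφ : φ.Surjective := fun y => (hfib' y).1
  have : Finite W := Finite.of_surjective φ hφ
  have hTuniv : StronglyConnectedOn ⟨T.Adj⟩ (Set.univ : Set W) := by
    obtain ⟨w⟩ := hT.1.nonempty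
    refine ⟨⟨w, trivial⟩, fun x _ y _ => ?_⟩
    refine Relation.ReflTransGen.mono (fun a b h => ⟨trivial, trivial, h⟩) _ _
      ((SimpleGraph.reachable_iff_reflTransGen x y).1 (hT.1.preconnected x y))
  -- Preimages of connected sets of tree vertices; adding one tree vertex adds one fibre, hence at
  -- most R vertices.
  let F : Set (Set V) := {S | ∃ Y, StronglyConnectedOn ⟨T.Adj⟩ Y ∧ S = φ ⁻¹' Y}
  have hF1 : ∀ S ∈ F, StronglyConnectedOn G₀ S := by
    rintro _ ⟨Y, hY, rfl⟩
    exact stronglyConnectedOn_preimage hfib' hedge hY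
  have hF2 : ∀ S ∈ F, S ≠ Set.univ → ∃ T ∈ F, S ⊂ T ∧ (T \ S).ncard ≤ R := by
    rintro _ ⟨Y, hY, rfl⟩ hne
    obtain ⟨c, -, hcY, -, hY'⟩ := exists_insert_stronglyConnectedOn hTuniv hY (Set.subset_univ _)
      (by rintro rfl; exact hne rfl)
    refine ⟨φ ⁻¹' (insert c Y), ⟨_, hY', rfl⟩, ⟨Set.preimage_mono (Set.subset_insert _ _), ?_⟩, ?_⟩
    · intro hsub
      obtain ⟨x, rfl⟩ := hφ c
      exact hcY (hsub (Or.inl rfl))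
    · refine (Set.ncard_le_ncard ?_).trans (hR c)
      rintro x ⟨hx | hx, hx'⟩
      · exact hx
      · exact absurd hx hx'
  have hV : Nat.card V ≤ R * Nat.card W := by
    have := ncard_preimage_le hR Set.univ
    rwa [Set.preimage_univ, Set.ncard_univ, Set.ncard_univ] at this
  by_cases hmW : m ≤ Nat.card W
  · obtain ⟨_, I, B, _, _, _, hI, hB, hdisj⟩ := exists_centred_sets hTuniv hm hmW le_rfl
    choose g hg using hφ
    have hginj : g.Injective := Function.LeftInverse.injective hg
    refine ⟨F, I.image g, fun o => φ ⁻¹' (B (φ o)), hF1, hF2, ?_, ?_, ?_⟩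
    · rwa [Finset.card_image_of_injective _ hginj, hI]
    · intro o ho
      obtain ⟨y, hy, rfl⟩ := Finset.mem_image.1 ho
      obtain ⟨h1, -, h2, h3⟩ := hB y hy
      simp only [hg]
      refine ⟨?_, ⟨_, h2, rfl⟩, ?_, ?_⟩
      · rwa [Set.mem_preimage, hg]
      · rw [← h3]
        exact ncard_le_ncard_preimage (fun y => ⟨g y, hg y⟩) _
      · rw [← h3]
        exact ncard_preimage_le hR _
    · intro o ho o' ho' h1 h2
      obtain ⟨y, hy, rfl⟩ := Finset.mem_image.1 ho
      obtain ⟨z, hz, rfl⟩ := Finset.mem_image.1 ho'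
      simp only [Set.mem_preimage, hg] at h1 h2
      rw [hdisj y hy z hz h1 h2]
  -- A tree with fewer than m vertices needs no centres, since then |V| ≤ Rm.
  · refine ⟨F, ∅, fun _ => ∅, hF1, hF2, hV.trans (Nat.mul_le_mul_left R ?_), by simp, by simp⟩
    omega

/-! ### Independent bits and a Chernoff bound -/

section Bits

variable {E : Type*}

/-- Membership of `ω` in the event `U` only depends on the elements of `D` that `ω` contains. -/
def DeterminedBy (U : Set (Set E)) (D : Set E) : Prop :=
  ∀ ω ω' : Set E, (∀ e ∈ D, e ∈ ω ↔ e ∈ ω') → (ω ∈ U ↔ ω' ∈ U)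

lemma DeterminedBy.mono {U : Set (Set E)} {D D' : Set E} (h : DeterminedBy U D) (hD : D ⊆ D') :
    DeterminedBy U D' :=
  fun ω ω' hω => h ω ω' fun e he => hω e (hD he)

lemma DeterminedBy.compl {U : Set (Set E)} {D : Set E} (h : DeterminedBy U D) :
    DeterminedBy Uᶜ D :=
  fun ω ω' hω => not_congr (h ω ω' hω)

lemma DeterminedBy.biInter {J : Type*} {I : Finset J} {U : J → Set (Set E)} {D : Set E}
    (h : ∀ j ∈ I, DeterminedBy (U j) D) : DeterminedBy (⋂ j ∈ I, U j) D := by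
  intro ω ω' hω
  simp only [Set.mem_iInter]
  exact forall₂_congr fun j hj => h j hj ω ω' hω

lemma determinedBy_mem (e : E) : DeterminedBy {ω : Set E | e ∈ ω} {e} :=
  fun _ _ h => h e rfl

/-- Events determined by disjoint sets of elements are independent under `μ`. -/
def IndepBits (μ : Measure (Set E)) : Prop :=
  ∀ (D D' : Set E), Disjoint D D' → ∀ U U' : Set (Set E), DeterminedBy U D → DeterminedBy U' D' →
    μ.real (U ∩ U') = μ.real U * μ.real U'

lemma indepBits_setBernoulli [Finite E] (u : Set E) (p : unitInterval) :
    IndepBits (setBernoulli u p) := by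
  classical
  intro D D' hD U U' hU hU'
  have hind := (iIndepFun_infinitePi (P := fun i : E =>
    unitInterval.toNNReal p • Measure.dirac (i ∈ u) +
      unitInterval.toNNReal (unitInterval.symm p) • Measure.dirac False)
    (X := fun i => id) (fun i => measurable_id)).indepFun_finset
      D.toFinite.toFinset D'.toFinite.toFinset (by simpa using hD) (fun i => by fun_prop)
  have hpre : ∀ (D : Set E) (U : Set (Set E)), DeterminedBy U D →
      ∃ A : Set (D.toFinite.toFinset → Prop), (fun f : E → Prop => {i | f i}) ⁻¹' U =
        (fun (f : E → Prop) (i : D.toFinite.toFinset) => id (f i)) ⁻¹' A := by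
    intro D U hU
    -- The restrictions to D of the configurations in U; as U is determined by D, its preimage is
    -- recovered exactly.
    refine ⟨{g | ∃ f : E → Prop, {i | f i} ∈ U ∧ ∀ i : D.toFinite.toFinset, g i = f i}, ?_⟩
    ext f
    refine ⟨fun hf => ⟨f, hf, fun _ => rfl⟩, ?_⟩
    rintro ⟨f', hf', h⟩
    refine (hU _ _ fun e he => ?_).1 hf'
    have := h ⟨e, by simpa using he⟩
    exact (iff_of_eq this).symm
  obtain ⟨A, hA⟩ := hpre D U hU
  obtain ⟨A', hA'⟩ := hpre D' U' hU'
  have := hind.measure_inter_preimage_eq_mul A A' .of_discrete .of_discrete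
  rw [measureReal_def, measureReal_def, measureReal_def, setBernoulli_apply', setBernoulli_apply',
    setBernoulli_apply', Set.preimage_inter, hA, hA', this, ENNReal.toReal_mul]

lemma setBernoulli_real_mem [Finite E] {u : Set E} (p : unitInterval) {e : E} (he : e ∈ u) :
    (setBernoulli u p).real {ω | e ∈ ω} = p := by
  rw [measureReal_def, setBernoulli_apply']
  have h := (measurePreserving_eval_infinitePi (fun i : E =>
    unitInterval.toNNReal p • Measure.dirac (i ∈ u) +
      unitInterval.toNNReal (unitInterval.symm p) • Measure.dirac False) e).measure_preimage
      (s := {True}) (MeasurableSet.nullMeasurableSet .of_discrete)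
  have h' : (fun f : E → Prop => {i | f i}) ⁻¹' {ω | e ∈ ω} =
      (Function.eval e : (E → Prop) → Prop) ⁻¹' {True} := by
    ext f
    simp
  rw [h', h]
  simp [he]

/-- Covers maps whose output bit e depends on the input bit g e alone, such as reversing all edges
or adjoining the initial ones. -/
lemma IndepBits.map [Finite E] {E' : Type*} [Finite E'] {μ : Measure (Set E)} (hμ : IndepBits μ)
    {f : Set E → Set E'} {g : E' → E} (hg : g.Injective)
    (hf : ∀ ω ω' e, (g e ∈ ω ↔ g e ∈ ω') → (e ∈ f ω ↔ e ∈ f ω')) : IndepBits (μ.map f) := by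
  intro D D' hD U U' hU hU'
  have key : ∀ (D : Set E') (U : Set (Set E')), DeterminedBy U D →
      DeterminedBy (f ⁻¹' U) (g '' D) := fun D U hU ω ω' h =>
    hU _ _ fun e he => hf ω ω' e (h (g e) ⟨e, he, rfl⟩)
  have hfm : Measurable f := .of_discrete
  rw [map_measureReal_apply hfm .of_discrete, map_measureReal_apply hfm .of_discrete,
    map_measureReal_apply hfm .of_discrete, Set.preimage_inter]
  exact hμ _ _ ((Set.disjoint_image_iff hg).2 hD) _ _ (key D U hU) (key D' U' hU')

variable {μ : Measure (Set E)} [IsProbabilityMeasure μ]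

lemma IndepBits.real_biInter (hμ : IndepBits μ) {J : Type*} (I : Finset J) (U : J → Set (Set E))
    (D : J → Set E) (hU : ∀ j ∈ I, DeterminedBy (U j) (D j))
    (hD : ∀ i ∈ I, ∀ j ∈ I, i ≠ j → Disjoint (D i) (D j)) :
    μ.real (⋂ j ∈ I, U j) = ∏ j ∈ I, μ.real (U j) := by
  classical
  induction I using Finset.induction_on with
  | empty => simp
  | insert a s ha ih =>
    rw [Finset.set_biInter_insert, Finset.prod_insert ha,
      hμ (D a) (⋃ j ∈ s, D j) ?_ _ _ (hU a (Finset.mem_insert_self _ _)) ?_, ih]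
    · exact fun j hj => hU j (Finset.mem_insert_of_mem hj)
    · exact fun i hi j hj => hD i (Finset.mem_insert_of_mem hi) j (Finset.mem_insert_of_mem hj)
    · simp only [Set.disjoint_iUnion_right]
      exact fun j hj => hD a (Finset.mem_insert_self _ _) j (Finset.mem_insert_of_mem hj)
        (by rintro rfl; exact ha hj)
    · exact DeterminedBy.biInter fun j hj => (hU j (Finset.mem_insert_of_mem hj)).mono
        (Set.subset_biUnion_of_mem (u := D) (Finset.mem_coe.2 hj))

lemma IndepBits.real_bits (hμ : IndepBits μ) (D : Finset E) (U : E → Set (Set E))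
    (hU : ∀ e ∈ D, DeterminedBy (U e) {e}) : μ.real (⋂ e ∈ D, U e) = ∏ e ∈ D, μ.real (U e) :=
  hμ.real_biInter D U (fun e => {e}) hU fun i _ j _ hij => by simpa using hij

lemma IndepBits.pow_le_real (hμ : IndepBits μ) {q : ℝ} (hq : 0 ≤ q) (D : Finset E)
    (hD : ∀ e ∈ D, q ≤ μ.real {ω | e ∈ ω}) : q ^ D.card ≤ μ.real {ω | ∀ e ∈ D, e ∈ ω} := by
  have h : {ω : Set E | ∀ e ∈ D, e ∈ ω} = ⋂ e ∈ D, {ω | e ∈ ω} := by ext; simp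
  rw [h, hμ.real_bits D _ fun e _ => determinedBy_mem e, ← Finset.prod_const]
  exact Finset.prod_le_prod (fun _ _ => hq) hD

variable [Finite E]

lemma real_notMem (e : E) : μ.real {ω | e ∉ ω} = 1 - μ.real {ω | e ∈ ω} :=
  probReal_compl_eq_one_sub .of_discrete

lemma IndepBits.real_le_pow (hμ : IndepBits μ) {q : ℝ} (D : Finset E)
    (hD : ∀ e ∈ D, q ≤ μ.real {ω | e ∈ ω}) :
    μ.real {ω | ∀ e ∈ D, e ∉ ω} ≤ (1 - q) ^ D.card := by
  have h : {ω : Set E | ∀ e ∈ D, e ∉ ω} = ⋂ e ∈ D, {ω | e ∉ ω} := by ext; simp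
  rw [h, hμ.real_bits D (fun e => {ω | e ∉ ω}) fun e _ => (determinedBy_mem e).compl, ← Finset.prod_const]
  refine Finset.prod_le_prod (fun _ _ => measureReal_nonneg) fun e he => ?_
  rw [real_notMem]
  linarith [hD e he]

/-- The event that `ω` meets `D` in `M`. -/
def traceEvent (D M : Finset E) : Set (Set E) := {ω | ∀ e ∈ D, e ∈ ω ↔ e ∈ M}

lemma determinedBy_traceEvent {E : Type*} (D M : Finset E) :
    DeterminedBy (traceEvent D M) (D : Set E) :=
  fun _ _ h => forall₂_congr fun e he => by rw [h e he]

lemma real_eq_sum_traceEvent (D : Finset E) (U : Set (Set E)) :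
    μ.real U = ∑ M ∈ D.powerset, μ.real (traceEvent D M ∩ U) := by
  classical
  rw [← measureReal_biUnion_finset]
  · congr 1
    ext ω
    simp only [Set.mem_iUnion, Set.mem_inter_iff, Finset.mem_powerset, exists_prop]
    refine ⟨fun h => ⟨D.filter (· ∈ ω), Finset.filter_subset _ _, fun e he => ?_, h⟩, ?_⟩
    · simp [he]
    · rintro ⟨_, _, _, h⟩
      exact h
  · intro M hM M' hM' hne
    refine Set.disjoint_left.2 fun ω h h' => hne ?_
    have hM := Finset.mem_powerset.1 hM
    have hM' := Finset.mem_powerset.1 hM'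
    ext e
    refine ⟨fun he => ?_, fun he => ?_⟩
    · exact (h'.1 e (hM he)).1 ((h.1 e (hM he)).2 he)
    · exact (h.1 e (hM' he)).1 ((h'.1 e (hM' he)).2 he)
  · exact fun _ _ => .of_discrete

lemma sum_traceEvent (D : Finset E) : ∑ M ∈ D.powerset, μ.real (traceEvent D M) = 1 := by
  have := real_eq_sum_traceEvent (μ := μ) D Set.univ
  simpa using this.symm

lemma IndepBits.real_traceEvent [DecidableEq E] (hμ : IndepBits μ) {D M : Finset E} (hM : M ⊆ D) :
    μ.real (traceEvent D M) =
      (∏ e ∈ M, μ.real {ω | e ∈ ω}) * ∏ e ∈ D \ M, (1 - μ.real {ω | e ∈ ω}) := by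
  have h : traceEvent D M = ⋂ e ∈ D, {ω | e ∈ ω ↔ e ∈ M} := by ext; simp [traceEvent]
  rw [h, hμ.real_bits D _ fun e _ => ?_, ← Finset.prod_sdiff hM, mul_comm]
  · congr 1
    · exact Finset.prod_congr rfl fun e he => by simp [he]
    · refine Finset.prod_congr rfl fun e he => ?_
      simp only [(Finset.mem_sdiff.1 he).2, iff_false]
      exact real_notMem e
  · exact fun ω ω' h => iff_congr (h e rfl) Iff.rfl

/-- A Chernoff bound for the lower tail of the number of elements of `D`. -/
lemma IndepBits.sum_traceEvent_le (hμ : IndepBits μ) {q : ℝ} (D : Finset E)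
    (hD : ∀ e ∈ D, q ≤ μ.real {ω | e ∈ ω}) (t : ℝ) :
    ∑ M ∈ D.powerset with (M.card : ℝ) ≤ t, μ.real (traceEvent D M) ≤
      Real.exp (t - q * D.card / 2) := by
  classical
  have he : Real.exp (-1) ≤ 1 / 2 := by
    rw [Real.exp_neg, inv_le_comm₀ (Real.exp_pos 1) (by norm_num)]
    have := Real.add_one_le_exp 1
    norm_num at this ⊢
    linarith
  calc ∑ M ∈ D.powerset with (M.card : ℝ) ≤ t, μ.real (traceEvent D M)
      ≤ ∑ M ∈ D.powerset, Real.exp t * (Real.exp (-1) ^ M.card * μ.real (traceEvent D M)) := by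
        refine (Finset.sum_le_sum fun M hM => ?_).trans (Finset.sum_le_sum_of_subset_of_nonneg
          (Finset.filter_subset _ _) fun _ _ _ => by positivity)
        rw [← mul_assoc, ← Real.exp_nat_mul, ← Real.exp_add]
        refine le_mul_of_one_le_left measureReal_nonneg (Real.one_le_exp ?_)
        linarith [(Finset.mem_filter.1 hM).2]
    -- The exponential moment with parameter -1 factorises by expanding the product over subsets.
    _ = Real.exp t * ∏ e ∈ D, (Real.exp (-1) * μ.real {ω | e ∈ ω} + (1 - μ.real {ω | e ∈ ω})) := by
        rw [← Finset.mul_sum, Finset.prod_add]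
        congr 1
        refine Finset.sum_congr rfl fun M hM => ?_
        rw [hμ.real_traceEvent (Finset.mem_powerset.1 hM), Finset.prod_mul_distrib,
          Finset.prod_const]
        ring
    _ ≤ Real.exp t * ∏ e ∈ D, Real.exp (-(q / 2)) := by
        refine mul_le_mul_of_nonneg_left (Finset.prod_le_prod (fun e _ => ?_) fun e he' => ?_)
          (by positivity)
        · have h1 : μ.real {ω : Set E | e ∈ ω} ≤ 1 := measureReal_le_one
          have : 0 ≤ Real.exp (-1) * μ.real {ω | e ∈ ω} := by positivity
          linarith
        · have h0 : 0 ≤ μ.real {ω : Set E | e ∈ ω} := measureReal_nonneg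
          have h1 := hD e he'
          have h2 := mul_le_mul_of_nonneg_right he h0
          have h3 := Real.add_one_le_exp (-(q / 2))
          linarith
    _ = Real.exp (t - q * D.card / 2) := by
        rw [Finset.prod_const, ← Real.exp_nat_mul, ← Real.exp_add]
        congr 1
        ring

end Bits

/-! ### Spreading through a random neighbourhood -/

lemma sum_cut_le {α : Type*} (N : Finset α) {q : ℝ} (hq1 : q ≤ 1) (hq : 0 ≤ q) :
    ∑ A ∈ N.powerset, (1 - q) ^ ((N.card - A.card + 1) * (A.card + 1)) ≤
      2 * Real.exp (-(q * N.card / 2)) * (1 + Real.exp (-(q * N.card / 2))) ^ N.card := by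
  classical
  set y := Real.exp (-(q * N.card / 2)) with hy
  -- The larger side of the cut has a + 1 ≥ |N|/2, so each of the b + 1 factors from the smaller
  -- side is at most y.
  have key : ∀ a b : ℕ, a + b = N.card → b ≤ a →
      (1 - q) ^ ((a + 1) * (b + 1)) ≤ y ^ (b + 1) := by
    intro a b hab hba
    have h1 : 1 - q ≤ Real.exp (-q) := by linarith [Real.add_one_le_exp (-q)]
    calc (1 - q) ^ ((a + 1) * (b + 1)) ≤ Real.exp (-q) ^ ((a + 1) * (b + 1)) :=
          pow_le_pow_left₀ (by linarith) h1 _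
      _ = Real.exp (-(q * (a + 1))) ^ (b + 1) := by
          rw [pow_mul, ← Real.exp_nat_mul]
          congr 2
          push_cast
          ring
      _ ≤ y ^ (b + 1) := by
          refine pow_le_pow_left₀ (Real.exp_pos _).le (Real.exp_le_exp.2 ?_) _
          have : (N.card : ℝ) ≤ 2 * (a + 1) := by
            rw [← hab]
            push_cast
            have : (b : ℝ) ≤ a := by exact_mod_cast hba
            linarith
          nlinarith
  have hterm : ∀ A ∈ N.powerset, (1 - q) ^ ((N.card - A.card + 1) * (A.card + 1)) ≤
      y * (y ^ A.card * 1 ^ (N.card - A.card) + 1 ^ A.card * y ^ (N.card - A.card)) := by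
    intro A hA
    have hcard := Finset.card_le_card (Finset.mem_powerset.1 hA)
    have hypos : 0 < y := Real.exp_pos _
    rcases le_total A.card (N.card - A.card) with h | h
    · have := key (N.card - A.card) A.card (by omega) h
      rw [pow_succ'] at this
      have h2 : 0 ≤ y * y ^ (N.card - A.card) := by positivity
      rw [one_pow, one_pow, mul_one, one_mul, mul_add y]
      linarith
    · have := key A.card (N.card - A.card) (by omega) h
      rw [pow_succ', mul_comm (A.card + 1)] at this
      have h2 : 0 ≤ y * y ^ A.card := by positivity
      rw [one_pow, one_pow, mul_one, one_mul, mul_add y]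
      linarith
  refine (Finset.sum_le_sum hterm).trans (le_of_eq ?_)
  rw [← Finset.mul_sum, Finset.sum_add_distrib, Finset.sum_pow_mul_eq_add_pow,
    Finset.sum_pow_mul_eq_add_pow]
  ring

section Spread

variable {V : Type*} [Finite V] {μ : Measure (Set (V × V))} [IsProbabilityMeasure μ]

/-- A is the set of vertices of N not reachable from u; an edge of ω across this cut would extend a
path. -/
lemma exists_cut_of_not_spreads {V : Type*} [DecidableEq V] {S : Set V} {ω : Set (V × V)}
    {v u w : V} {N : Finset V} (hN : ∀ k ∈ S, k ≠ u → k ≠ w → (v, k) ∈ ω → k ∈ N)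
    (hNω : ∀ k ∈ N, k ∈ S ∧ (v, k) ∈ ω)
    (hs : ¬ Spreads S ω v u w) :
    ∃ A ⊆ N, ∀ e ∈ insert u (N \ A) ×ˢ insert w A, e ∉ ω := by
  classical
  refine ⟨N.filter fun k => ¬ Relation.ReflTransGen
    (fun a b => (a, b) ∈ ω ∧ (b = w ∨ b ∈ S ∧ (v, b) ∈ ω)) u k, Finset.filter_subset _ _, ?_⟩
  rintro ⟨a, b⟩ he hab
  obtain ⟨ha, hb⟩ := Finset.mem_product.1 he
  have ha' : Relation.ReflTransGen
      (fun a b => (a, b) ∈ ω ∧ (b = w ∨ b ∈ S ∧ (v, b) ∈ ω)) u a := by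
    rcases Finset.mem_insert.1 ha with h | h
    · simp only at h
      rw [h]
    · simp only [Finset.mem_sdiff, Finset.mem_filter, not_and, not_not] at h
      exact h.2 h.1
  rcases Finset.mem_insert.1 hb with h | h
  · simp only at h
    subst h
    exact hs (ha'.tail ⟨hab, Or.inl rfl⟩)
  · obtain ⟨hbN, hb'⟩ := Finset.mem_filter.1 h
    exact hb' (ha'.tail ⟨hab, Or.inr (hNω b hbN)⟩)

/-- Once the out-neighbours N of v are revealed, a union bound over cuts applies: no cut edge starts
at v, so the cuts are independent of what was revealed. -/
lemma real_trace_inter_not_spreads_le [DecidableEq V] (hμ : IndepBits μ) {q : ℝ}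
    (hq0 : 0 ≤ q) (hq1 : q ≤ 1) (hq : ∀ a b, a ≠ b → q ≤ μ.real {ω | (a, b) ∈ ω}) {S : Set V}
    {v u w : V} (hv : v ∉ S) (huv : u ≠ v) (huw : u ≠ w) {K N : Finset V}
    (hK : ∀ k, k ∈ K ↔ k ∈ S ∧ k ≠ u ∧ k ≠ w) (hN : N ⊆ K) :
    μ.real (traceEvent (K.image (Prod.mk v)) (N.image (Prod.mk v)) ∩ {ω | ¬ Spreads S ω v u w}) ≤
      μ.real (traceEvent (K.image (Prod.mk v)) (N.image (Prod.mk v))) *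
        (2 * Real.exp (-(q * N.card / 2)) * (1 + Real.exp (-(q * N.card / 2))) ^ N.card) := by
  have hinj : Function.Injective (Prod.mk v : V → V × V) := fun a b h => (Prod.mk.inj h).2
  set X := traceEvent (K.image (Prod.mk v)) (N.image (Prod.mk v)) with hX
  let Y : Finset V → Set (Set (V × V)) := fun A =>
    {ω | ∀ e ∈ insert u (N \ A) ×ˢ insert w A, e ∉ ω}
  have hsub : X ∩ {ω | ¬ Spreads S ω v u w} ⊆ ⋃ A ∈ N.powerset, X ∩ Y A := by
    rintro ω ⟨hω, hs⟩
    have hiff : ∀ k ∈ K, (v, k) ∈ ω ↔ k ∈ N := by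
      intro k hk
      rw [hω (v, k) (Finset.mem_image_of_mem _ hk), hinj.mem_finset_image]
    obtain ⟨A, hA, h⟩ := exists_cut_of_not_spreads (N := N)
      (fun k hkS hku hkw hk => (hiff k ((hK k).2 ⟨hkS, hku, hkw⟩)).1 hk)
      (fun k hk => ⟨((hK k).1 (hN hk)).1, (hiff k (hN hk)).2 hk⟩) hs
    exact Set.mem_biUnion (Finset.mem_coe.2 (Finset.mem_powerset.2 hA)) ⟨hω, h⟩
  calc μ.real (X ∩ {ω | ¬ Spreads S ω v u w}) ≤ ∑ A ∈ N.powerset, μ.real (X ∩ Y A) :=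
        (measureReal_mono hsub (measure_ne_top _ _)).trans (measureReal_biUnion_finset_le _ _)
    _ ≤ ∑ A ∈ N.powerset, μ.real X * (1 - q) ^ ((N.card - A.card + 1) * (A.card + 1)) := by
        refine Finset.sum_le_sum fun A hA => ?_
        have hA := Finset.mem_powerset.1 hA
        have hNK : ∀ k ∈ N, k ∈ S ∧ k ≠ u ∧ k ≠ w := fun k hk => (hK k).1 (hN hk)
        have hne : ∀ e ∈ insert u (N \ A) ×ˢ insert w A, e.1 ≠ e.2 ∧ e.1 ≠ v := by
          rintro ⟨a, b⟩ he
          obtain ⟨ha, hb⟩ := Finset.mem_product.1 he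
          simp only [Finset.mem_insert, Finset.mem_sdiff] at ha hb
          constructor
          · rintro (rfl : a = b)
            rcases ha with rfl | ha <;> rcases hb with rfl | hb
            · exact huw rfl
            · exact (hNK _ (hA hb)).2.1 rfl
            · exact (hNK _ ha.1).2.2 rfl
            · exact ha.2 hb
          · rintro (rfl : a = v)
            rcases ha with rfl | ha
            · exact huv rfl
            · exact hv (hNK _ ha.1).1
        rw [hμ (K.image (Prod.mk v) : Finset _) (insert u (N \ A) ×ˢ insert w A : Finset _) ?_ X
          (Y A) (determinedBy_traceEvent _ _) ?_]
        · refine mul_le_mul_of_nonneg_left ?_ measureReal_nonneg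
          have := hμ.real_le_pow (insert u (N \ A) ×ˢ insert w A) (q := q)
            fun e he => hq e.1 e.2 (hne e he).1
          rwa [Finset.card_product, Finset.card_insert_of_notMem, Finset.card_insert_of_notMem,
            Finset.card_sdiff_of_subset hA] at this
          · exact fun h => (hNK _ (hA h)).2.2 rfl
          · exact fun h => (hNK _ (Finset.mem_sdiff.1 h).1).2.1 rfl
        · rw [Finset.disjoint_coe, Finset.disjoint_left]
          intro e he he'
          obtain ⟨k, _, rfl⟩ := Finset.mem_image.1 he
          exact (hne _ he').2 rfl
        · intro ω ω' h
          exact forall₂_congr fun e he => not_congr (h e he)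
    _ ≤ _ := by
        rw [← Finset.mul_sum]
        exact mul_le_mul_of_nonneg_left (sum_cut_le N hq1 hq0) measureReal_nonneg

/-- With `s` potential intermediate vertices and `q² s` large, spreading succeeds with high probability. -/
lemma real_not_spreads_le (hμ : IndepBits μ) {q : ℝ}
    (hq0 : 0 < q) (hq1 : q ≤ 1) (hq : ∀ a b, a ≠ b → q ≤ μ.real {ω | (a, b) ∈ ω}) {S : Set V}
    {v u w : V} (hv : v ∉ S) (huv : u ≠ v) (huw : u ≠ w) (hS : 4 ≤ S.ncard)
    (hlarge : 4 / q ≤ Real.exp (q ^ 2 * S.ncard / 32)) :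
    μ.real {ω | ¬ Spreads S ω v u w} ≤ 7 * Real.exp (-(q ^ 2 * S.ncard / 16)) := by
  classical
  set K : Finset V := (S.toFinite.toFinset.erase u).erase w with hKdef
  have hK : ∀ k, k ∈ K ↔ k ∈ S ∧ k ≠ u ∧ k ≠ w := by
    intro k
    simp only [hKdef, Finset.mem_erase, Set.Finite.mem_toFinset]
    tauto
  have hcard : (S.ncard : ℝ) / 2 ≤ K.card := by
    have h1 : S.ncard ≤ K.card + 2 := by
      rw [Set.ncard_eq_toFinset_card S, hKdef]
      have := Finset.pred_card_le_card_erase (s := S.toFinite.toFinset) (a := u)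
      have := Finset.pred_card_le_card_erase (s := S.toFinite.toFinset.erase u) (a := w)
      omega
    have h2 : S.ncard ≤ 2 * K.card := by omega
    have h3 : (S.ncard : ℝ) ≤ 2 * K.card := by exact_mod_cast h2
    linarith
  have hinj : Function.Injective (Prod.mk v : V → V × V) := fun a b h => (Prod.mk.inj h).2
  set D : Finset (V × V) := K.image (Prod.mk v) with hD
  set s : ℝ := (S.ncard : ℝ) with hs
  set ε := Real.exp (-(q ^ 2 * s / 16)) with hε
  have hs0 : (0 : ℝ) ≤ s := Nat.cast_nonneg _
  have hDcard : (D.card : ℝ) = K.card := by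
    rw [hD, Finset.card_image_of_injective _ hinj]
  have hqD : ∀ e ∈ D, q ≤ μ.real {ω | e ∈ ω} := by
    intro e he
    obtain ⟨k, hk, rfl⟩ := Finset.mem_image.1 he
    exact hq v k fun h => hv (h ▸ ((hK k).1 hk).1)
  -- At a quarter of the mean lower bound q|K|, the Chernoff bound is exp(-t).
  set t : ℝ := q * K.card / 4 with ht
  have hqK : q ^ 2 * s / 8 ≤ q * t := by
    rw [ht]
    nlinarith [mul_le_mul_of_nonneg_left hcard (sq_nonneg q)]
  have hsmall : ∑ M ∈ D.powerset with (M.card : ℝ) ≤ t,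
      μ.real (traceEvent D M ∩ {ω | ¬ Spreads S ω v u w}) ≤ ε := by
    calc _ ≤ ∑ M ∈ D.powerset with (M.card : ℝ) ≤ t, μ.real (traceEvent D M) :=
          Finset.sum_le_sum fun M _ => measureReal_mono Set.inter_subset_left
      _ ≤ _ := hμ.sum_traceEvent_le D hqD t
      _ ≤ ε := by
          refine Real.exp_le_exp.2 ?_
          rw [hDcard]
          have h1 : q * t ≤ t := by
            have : 0 ≤ t := by positivity
            nlinarith
          have h2 : 0 ≤ q ^ 2 * s := by positivity
          have h3 : q * K.card / 2 = 2 * t := by rw [ht]; ring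
          rw [h3]
          linarith
  have hbig : ∑ M ∈ D.powerset with ¬ (M.card : ℝ) ≤ t,
      μ.real (traceEvent D M ∩ {ω | ¬ Spreads S ω v u w}) ≤ 6 * ε := by
    calc _ ≤ ∑ M ∈ D.powerset with ¬ (M.card : ℝ) ≤ t, μ.real (traceEvent D M) * (6 * ε) := by
          refine Finset.sum_le_sum fun M hM => ?_
          obtain ⟨hMD, hMt⟩ := Finset.mem_filter.1 hM
          obtain ⟨N, hNK, rfl⟩ := Finset.subset_image_iff.1 (Finset.mem_powerset.1 hMD)
          rw [Finset.card_image_of_injective _ hinj] at hMt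
          have hNt : t ≤ N.card := (not_le.1 hMt).le
          refine (real_trace_inter_not_spreads_le hμ hq0.le hq1 hq hv huv huw hK hNK).trans
            (mul_le_mul_of_nonneg_left ?_ measureReal_nonneg)
          set y := Real.exp (-(q * N.card / 2)) with hy
          have hqt : q * t ≤ q * N.card := mul_le_mul_of_nonneg_left hNt hq0.le
          have hyε : y ≤ ε := Real.exp_le_exp.2 (by linarith)
          -- This keeps (1 + y)^|N| bounded. Split y into two equal factors: one brings |N| down to
          -- 4/q, the other is at most q/4 by `hlarge`.
          have hNy : N.card * y ≤ 1 := by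
            have h1 : y = Real.exp (-(q * N.card / 4)) * Real.exp (-(q * N.card / 4)) := by
              rw [hy, ← Real.exp_add]
              congr 1
              ring
            have h2 : q * N.card / 4 * Real.exp (-(q * N.card / 4)) ≤ 1 := by
              rw [Real.exp_neg, ← div_eq_mul_inv, div_le_one (Real.exp_pos _)]
              linarith [Real.add_one_le_exp (q * N.card / 4)]
            have h3 : Real.exp (-(q * N.card / 4)) ≤ q / 4 := by
              rw [Real.exp_neg, inv_le_comm₀ (Real.exp_pos _) (by positivity), inv_div]
              exact hlarge.trans (Real.exp_le_exp.2 (by linarith))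
            have h4 : N.card * Real.exp (-(q * N.card / 4)) ≤ 4 / q := by
              rw [le_div_iff₀ hq0]
              linarith
            calc N.card * y = N.card * Real.exp (-(q * N.card / 4)) *
                  Real.exp (-(q * N.card / 4)) := by rw [h1]; ring
              _ ≤ 4 / q * (q / 4) := by gcongr
              _ = 1 := by field_simp
          have hpow : (1 + y) ^ N.card ≤ 3 := by
            calc (1 + y) ^ N.card ≤ Real.exp y ^ N.card :=
                  pow_le_pow_left₀ (by positivity) (by linarith [Real.add_one_le_exp y]) _
              _ = Real.exp (N.card * y) := (Real.exp_nat_mul _ _).symm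
              _ ≤ Real.exp 1 := Real.exp_le_exp.2 hNy
              _ ≤ 3 := by linarith [Real.exp_one_lt_d9]
          have hy0 : 0 ≤ y := (Real.exp_pos _).le
          calc 2 * y * (1 + y) ^ N.card ≤ 2 * ε * 3 := by gcongr
            _ = 6 * ε := by ring
      _ ≤ ∑ M ∈ D.powerset, μ.real (traceEvent D M) * (6 * ε) :=
          Finset.sum_le_sum_of_subset_of_nonneg (Finset.filter_subset _ _)
            fun _ _ _ => by positivity
      _ = 6 * ε := by rw [← Finset.sum_mul, sum_traceEvent, one_mul]
  rw [real_eq_sum_traceEvent D, ← Finset.sum_filter_add_sum_filter_not _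
    (fun M => (M.card : ℝ) ≤ t)]
  linarith

end Spread

/-! ### Growth along the exhaustion -/

section Growth

variable {V : Type*} [Finite V] {μ : Measure (Set (V × V))} [IsProbabilityMeasure μ]

lemma IndepBits.map_swap {μ : Measure (Set (V × V))} (hμ : IndepBits μ) :
    IndepBits (μ.map (Prod.swap ⁻¹' ·)) :=
  hμ.map Prod.swap_injective fun _ _ _ h => h

/-- Union bound over at most R(2|S|)² triples (v, u, w), using |T| ≤ 2|S|. -/
lemma real_not_spreadsOut_le (hμ : IndepBits μ) {q : ℝ} (hq0 : 0 < q) (hq1 : q ≤ 1)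
    (hq : ∀ a b, a ≠ b → q ≤ μ.real {ω | (a, b) ∈ ω}) {S T : Set V} {R : ℕ}
    (hTS : (T \ S).ncard ≤ R) (hRS : R ≤ S.ncard) (hS : 4 ≤ S.ncard)
    (hlarge : 4 / q ≤ Real.exp (q ^ 2 * S.ncard / 32)) :
    μ.real {ω | ¬ SpreadsOut S T ω} ≤
      28 * R * (S.ncard : ℝ) ^ 2 * Real.exp (-(q ^ 2 * S.ncard / 16)) := by
  classical
  set J : Finset (V × V × V) := ((T \ S).toFinite.toFinset ×ˢ (T.toFinite.toFinset ×ˢ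
    T.toFinite.toFinset)).filter fun x => x.2.1 ≠ x.1 ∧ x.2.2 ≠ x.1 ∧ x.2.1 ≠ x.2.2 with hJ
  have hTcard : T.ncard ≤ 2 * S.ncard := by
    have h1 : T.ncard ≤ ((T \ S) ∪ S).ncard := Set.ncard_le_ncard (by simp)
    have h2 := Set.ncard_union_le (T \ S) S
    omega
  have hJcard : (J.card : ℝ) ≤ 4 * R * (S.ncard : ℝ) ^ 2 := by
    have h1 : J.card ≤ R * ((2 * S.ncard) * (2 * S.ncard)) := by
      refine (Finset.card_filter_le _ _).trans ?_
      rw [Finset.card_product, Finset.card_product, ← Set.ncard_eq_toFinset_card,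
        ← Set.ncard_eq_toFinset_card]
      gcongr
    calc (J.card : ℝ) ≤ ((R * ((2 * S.ncard) * (2 * S.ncard)) : ℕ) : ℝ) := by exact_mod_cast h1
      _ = _ := by push_cast; ring
  have hsub : {ω | ¬ SpreadsOut S T ω} ⊆ ⋃ x ∈ J, {ω | ¬ Spreads S ω x.1 x.2.1 x.2.2} := by
    intro ω hω
    simp only [SpreadsOut, Set.mem_ofPred_eq, not_forall] at hω
    obtain ⟨v, hv, u, hu, w, hw, h1, h2, h3, h⟩ := hω
    refine Set.mem_biUnion (x := (v, u, w)) ?_ h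
    rw [hJ, Finset.mem_coe, Finset.mem_filter]
    simp only [Finset.mem_product, Set.Finite.mem_toFinset]
    exact ⟨⟨hv, hu, hw⟩, h1, h2, h3⟩
  calc μ.real {ω | ¬ SpreadsOut S T ω}
      ≤ ∑ x ∈ J, μ.real {ω | ¬ Spreads S ω x.1 x.2.1 x.2.2} :=
        (measureReal_mono hsub (measure_ne_top _ _)).trans (measureReal_biUnion_finset_le _ _)
    _ ≤ ∑ x ∈ J, 7 * Real.exp (-(q ^ 2 * S.ncard / 16)) := by
        refine Finset.sum_le_sum fun x hx => ?_
        rw [hJ, Finset.mem_filter] at hx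
        simp only [Finset.mem_product, Set.Finite.mem_toFinset] at hx
        exact real_not_spreads_le hμ hq0 hq1 hq hx.1.1.2 hx.2.1 hx.2.2.2 hS hlarge
    _ = J.card * (7 * Real.exp (-(q ^ 2 * S.ncard / 16))) := by
        rw [Finset.sum_const, nsmul_eq_mul]
    _ ≤ 4 * R * (S.ncard : ℝ) ^ 2 * (7 * Real.exp (-(q ^ 2 * S.ncard / 16))) := by gcongr
    _ = _ := by ring

/-- Along an exhaustion by strongly connected sets, filledness of a large set fails to propagate to
the whole vertex set only on a decreasing event of small probability. -/
lemma exists_bad_event (hμ : IndepBits μ) {q : ℝ} (hq0 : 0 < q) (hq1 : q ≤ 1)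
    (hq : ∀ a b, a ≠ b → q ≤ μ.real {ω | (a, b) ∈ ω}) {G₀ : Digraph V} {R m : ℕ}
    {F : Set (Set V)} (hF : ∀ S ∈ F, StronglyConnectedOn G₀ S)
    (hgrow : ∀ S ∈ F, S ≠ Set.univ → ∃ T ∈ F, S ⊂ T ∧ (T \ S).ncard ≤ R)
    (hRm : R ≤ m) (hm : 4 ≤ m) (hlarge : 4 / q ≤ Real.exp (q ^ 2 * m / 32)) {S : Set V}
    (hSF : S ∈ F) (hmS : m ≤ S.ncard) :
    ∃ Bad : Set (Set (V × V)), IsLowerSet Bad ∧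
      μ.real Bad ≤ ∑ k ∈ Finset.Ico S.ncard (Nat.card V),
        56 * R * (k : ℝ) ^ 2 * Real.exp (-(q ^ 2 * k / 16)) ∧
      ∀ ω ∉ Bad, ∀ O, TransitiveWithin O ω → edges G₀ ⊆ O → Filled O ω S S →
        Filled O ω Set.univ Set.univ := by
  induction hd : Nat.card V - S.ncard using Nat.strong_induction_on generalizing S with
  | _ d ih =>
  by_cases hS : S = Set.univ
  · subst hS
    refine ⟨∅, isLowerSet_empty, ?_, fun _ _ _ _ _ h => h⟩
    rw [measureReal_empty]
    exact Finset.sum_nonneg fun _ _ => by positivity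
  obtain ⟨T, hTF, hST, hTR⟩ := hgrow S hSF hS
  have hlt : S.ncard < T.ncard := Set.ncard_lt_ncard hST
  have hTV : T.ncard ≤ Nat.card V := by
    rw [← Set.ncard_univ]
    exact Set.ncard_le_ncard (Set.subset_univ _)
  obtain ⟨Bad, hlow, hprob, hfill⟩ := ih _ (by omega) hTF (by omega) rfl
  have hlarge' : 4 / q ≤ Real.exp (q ^ 2 * S.ncard / 32) := by
    refine hlarge.trans (Real.exp_le_exp.2 ?_)
    have : (m : ℝ) ≤ S.ncard := by exact_mod_cast hmS
    gcongr
  have hmono : ∀ ω ω' : Set (V × V), ω ⊆ ω' → SpreadsOut S T ω → SpreadsOut S T ω' :=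
    fun ω ω' h hs v hv u hu w hw h1 h2 h3 => (hs v hv u hu w hw h1 h2 h3).mono h
  set B1 : Set (Set (V × V)) := {ω | ¬ SpreadsOut S T ω} with hB1
  set B2 : Set (Set (V × V)) := {ω | ¬ SpreadsOut S T (Prod.swap ⁻¹' ω)} with hB2
  have hP1 : μ.real B1 ≤ 28 * R * (S.ncard : ℝ) ^ 2 * Real.exp (-(q ^ 2 * S.ncard / 16)) :=
    real_not_spreadsOut_le hμ hq0 hq1 hq hTR (by omega) (by omega) hlarge'
  have hP2 : μ.real B2 ≤ 28 * R * (S.ncard : ℝ) ^ 2 * Real.exp (-(q ^ 2 * S.ncard / 16)) := by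
    have hmeas : Measurable (fun ω : Set (V × V) => Prod.swap ⁻¹' ω) := .of_discrete
    have : IsProbabilityMeasure (μ.map (fun ω : Set (V × V) => Prod.swap ⁻¹' ω)) :=
      Measure.isProbabilityMeasure_map hmeas.aemeasurable
    have h := real_not_spreadsOut_le hμ.map_swap hq0 hq1 (fun a b hab => ?_) hTR (by omega)
      (by omega) hlarge'
    · rwa [map_measureReal_apply hmeas .of_discrete] at h
    · rw [map_measureReal_apply hmeas .of_discrete]
      exact hq b a hab.symm
  refine ⟨B1 ∪ B2 ∪ Bad, ?_, ?_, ?_⟩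
  · refine IsLowerSet.union (IsLowerSet.union ?_ ?_) hlow
    · exact fun ω ω' h hω hs => hω (hmono _ _ h hs)
    · exact fun ω ω' h hω hs => hω (hmono _ _ (Set.preimage_mono h) hs)
  · have h1 : μ.real (B1 ∪ B2 ∪ Bad) ≤ μ.real B1 + μ.real B2 + μ.real Bad :=
      (measureReal_union_le _ _).trans (add_le_add (measureReal_union_le _ _) le_rfl)
    -- Sizes strictly increase, so each k is charged at most once; the term k = |S| pays for both
    -- orientations, 56 = 28 + 28.
    rw [← Finset.sum_Ioo_add_eq_sum_Ico (hlt.trans_le hTV)]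
    have h2 : ∑ k ∈ Finset.Ico T.ncard (Nat.card V),
        56 * R * (k : ℝ) ^ 2 * Real.exp (-(q ^ 2 * k / 16)) ≤
        ∑ k ∈ Finset.Ioo S.ncard (Nat.card V),
          56 * R * (k : ℝ) ^ 2 * Real.exp (-(q ^ 2 * k / 16)) := by
      refine Finset.sum_le_sum_of_subset_of_nonneg (fun k hk => ?_) fun _ _ _ => by positivity
      simp only [Finset.mem_Ico, Finset.mem_Ioo] at hk ⊢
      omega
    linarith
  · intro ω hω O hO hG hfil
    simp only [hB1, hB2, Set.mem_union, Set.mem_ofPred_eq, not_or, not_not] at hω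
    exact hfill ω hω.2 O hO hG (hfil.step hO hG hST.subset (hF S hSF).1 (hF T hTF)
      hω.1.1 hω.1.2)

end Growth

/-! ### Nucleation and its correlation with growth -/

section Nucleation

/-- The edges between `o` and the other vertices of `S`. -/
def starEdges {V : Type*} (S : Set V) (o : V) : Set (V × V) :=
  {e | e.1 ≠ e.2 ∧ e.1 ∈ S ∧ e.2 ∈ S ∧ (e.1 = o ∨ e.2 = o)}

lemma starIn_of_starEdges_subset {V : Type*} {S : Set V} {o : V} (ho : o ∈ S) {ω : Set (V × V)}
    (h : starEdges S o ⊆ ω) : StarIn S o ω :=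
  fun _ hx hxo => ⟨h ⟨hxo.symm, ho, hx, Or.inl rfl⟩, h ⟨hxo, hx, ho, Or.inr rfl⟩⟩

lemma ncard_starEdges_le {V : Type*} [Finite V] (S : Set V) (o : V) :
    (starEdges S o).ncard ≤ 2 * S.ncard := by
  have hsub : starEdges S o ⊆ Prod.mk o '' S ∪ (fun x => (x, o)) '' S := by
    rintro ⟨a, b⟩ ⟨-, ha, hb, rfl | rfl⟩
    · exact Or.inl ⟨b, hb, rfl⟩
    · exact Or.inr ⟨a, ha, rfl⟩
  have h1 := Set.ncard_le_ncard hsub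
  have h2 := Set.ncard_union_le (Prod.mk o '' S) ((fun x => (x, o)) '' S)
  have h3 := Set.ncard_image_le (f := Prod.mk o) S.toFinite
  have h4 := Set.ncard_image_le (f := fun x => (x, o)) S.toFinite
  omega

/-- A common edge would join o and o', putting each centre in the other's set. -/
lemma disjoint_starEdges {V : Type*} {S S' : Set V} {o o' : V} (hne : o ≠ o')
    (h : o ∈ S' → o' ∈ S → o = o') : Disjoint (starEdges S o) (starEdges S' o') := by
  rw [Set.disjoint_left]
  rintro ⟨a, b⟩ ⟨-, ha, hb, h1⟩ ⟨-, ha', hb', h2⟩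
  simp only at *
  rcases h1 with rfl | rfl <;> rcases h2 with rfl | rfl
  · exact hne rfl
  · exact hne (h ha' hb)
  · exact hne (h hb' ha)
  · exact hne rfl

/-- The event of containing a given set is negatively correlated with decreasing events. -/
lemma IndepBits.real_superset_inter_le {E : Type*} [Finite E] {μ : Measure (Set E)}
    [IsProbabilityMeasure μ] (hμ : IndepBits μ) (D : Set E) {L : Set (Set E)} (hL : IsLowerSet L) :
    μ.real ({ω | D ⊆ ω} ∩ L) ≤ μ.real {ω | D ⊆ ω} * μ.real L := by
  -- Forcing D into ω turns L into an event determined by the complement of D: it agrees with L when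
  -- D ⊆ ω and is contained in L because L is a lower set.
  have h1 : {ω | D ⊆ ω} ∩ L ⊆ {ω | D ⊆ ω} ∩ {ω | ω ∪ D ∈ L} := by
    rintro ω ⟨hD, hω⟩
    exact ⟨hD, by rwa [Set.mem_ofPred_eq, Set.union_eq_self_of_subset_right hD]⟩
  have h2 : {ω | ω ∪ D ∈ L} ⊆ L := fun ω hω => hL Set.subset_union_left hω
  refine (measureReal_mono h1 (measure_ne_top _ _)).trans ?_
  rw [hμ D Dᶜ disjoint_compl_right {ω | D ⊆ ω} _ (fun ω ω' h => forall₂_congr h) ?_]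
  · exact mul_le_mul_of_nonneg_left (measureReal_mono h2 (measure_ne_top _ _)) measureReal_nonneg
  · intro ω ω' h
    have : ω ∪ D = ω' ∪ D := by
      ext e
      by_cases he : e ∈ D
      · simp [he]
      · simp [he, h e he]
    simp only [Set.mem_ofPred_eq, this]

/-- Terms at most 1 overshoot g by at most 1. This caps the expected number of complete stars, which
multiplies the growth failure in the union bound. -/
lemma exists_subset_sum_mem_Icc {ι : Type*} (I : Finset ι) (f : ι → ℝ) (hf : ∀ i, f i ≤ 1)
    {g : ℝ} (hg0 : 0 ≤ g) (hg : g ≤ ∑ i ∈ I, f i) :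
    ∃ J ⊆ I, g ≤ ∑ i ∈ J, f i ∧ ∑ i ∈ J, f i ≤ g + 1 := by
  classical
  induction I using Finset.induction_on with
  | empty =>
    refine ⟨∅, subset_rfl, hg, ?_⟩
    rw [Finset.sum_empty]
    linarith
  | insert a s ha ih =>
    by_cases h : g ≤ ∑ i ∈ s, f i
    · obtain ⟨J, hJ, h⟩ := ih h
      exact ⟨J, hJ.trans (Finset.subset_insert _ _), h⟩
    · refine ⟨insert a s, subset_rfl, hg, ?_⟩
      rw [Finset.sum_insert ha]
      linarith [hf a]

/-- A quantitative bound for the probability that nucleation or growth fails. -/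
lemma IsRUnoriented.real_not_filled_le {V : Type*} [Finite V] {μ : Measure (Set (V × V))}
    [IsProbabilityMeasure μ] (hμ : IndepBits μ) {q : ℝ} (hq0 : 0 < q) (hq1 : q ≤ 1)
    (hq : ∀ a b, a ≠ b → q ≤ μ.real {ω | (a, b) ∈ ω}) {G₀ : Digraph V} {R m : ℕ}
    (hG₀ : IsRUnoriented R G₀) (hR : 1 ≤ R) (hRm : R ≤ m) (hm : 4 ≤ m)
    (hlarge : 4 / q ≤ Real.exp (q ^ 2 * m / 32)) {g δ : ℝ} (hg0 : 0 ≤ g)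
    (hg : g ≤ ((Nat.card V : ℝ) / R - m) * q ^ (2 * (R * m)))
    (hδ : ∑ k ∈ Finset.Ico m (Nat.card V), 56 * R * (k : ℝ) ^ 2 * Real.exp (-(q ^ 2 * k / 16)) ≤ δ) :
    μ.real {ω | ∃ O, TransitiveWithin O ω ∧ edges G₀ ⊆ O ∧ ¬ Filled O ω Set.univ Set.univ} ≤
      Real.exp (-g) + (g + 1) * δ := by
  classical
  obtain ⟨F, I, B, hF, hgrow, hcard, hB, hdisj⟩ := hG₀.exists_blocks (show 1 ≤ m by omega)
  set N : V → Set (Set (V × V)) := fun o => {ω | starEdges (B o) o ⊆ ω} with hN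
  have hNprob : ∀ o ∈ I, q ^ (2 * (R * m)) ≤ μ.real (N o) := by
    intro o ho
    have h := hμ.pow_le_real hq0.le (starEdges (B o) o).toFinite.toFinset fun e he =>
      hq e.1 e.2 ((Set.Finite.mem_toFinset _).1 he).1
    rw [← Set.ncard_eq_toFinset_card] at h
    have h2 : (starEdges (B o) o).ncard ≤ 2 * (R * m) :=
      (ncard_starEdges_le _ _).trans (Nat.mul_le_mul_left 2 (hB o ho).2.2.2)
    refine (pow_le_pow_of_le_one hq0.le hq1 h2).trans (h.trans (le_of_eq ?_))
    congr 1
    ext ω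
    simp [hN, Set.subset_def]
  have hgI : g ≤ ∑ o ∈ I, μ.real (N o) := by
    have h1 : (Nat.card V : ℝ) / R - m ≤ I.card := by
      have hR' : (0 : ℝ) < R := by exact_mod_cast hR
      have h2 : (Nat.card V : ℝ) ≤ R * (I.card + m) := by exact_mod_cast hcard
      have h3 : (Nat.card V : ℝ) / R ≤ I.card + m := by
        rw [div_le_iff₀ hR']
        linarith
      linarith
    calc g ≤ ((Nat.card V : ℝ) / R - m) * q ^ (2 * (R * m)) := hg
      _ ≤ I.card * q ^ (2 * (R * m)) := by gcongr
      _ = ∑ o ∈ I, q ^ (2 * (R * m)) := by rw [Finset.sum_const, nsmul_eq_mul]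
      _ ≤ _ := Finset.sum_le_sum hNprob
  obtain ⟨J, hJI, hgJ, hJg⟩ := exists_subset_sum_mem_Icc I (fun o => μ.real (N o))
    (fun o => measureReal_le_one) hg0 hgI
  have hbad : ∀ o ∈ J, ∃ Bad : Set (Set (V × V)), IsLowerSet Bad ∧ μ.real Bad ≤ δ ∧
      ∀ ω ∉ Bad, ∀ O, TransitiveWithin O ω → edges G₀ ⊆ O → Filled O ω (B o) (B o) →
        Filled O ω Set.univ Set.univ := by
    intro o ho
    obtain ⟨-, h2, h3, -⟩ := hB o (hJI ho)
    obtain ⟨Bad, hlow, hprob, hfill⟩ :=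
      exists_bad_event hμ hq0 hq1 hq hF hgrow hRm hm hlarge h2 h3
    refine ⟨Bad, hlow, hprob.trans (le_trans ?_ hδ), hfill⟩
    exact Finset.sum_le_sum_of_subset_of_nonneg (Finset.Ico_subset_Ico_left h3)
      fun _ _ _ => by positivity
  choose! Bad hlow hprob hfill using hbad
  -- Failure means that no star of J is complete, or that some complete star meets its own bad
  -- event.
  have hsub : {ω | ∃ O, TransitiveWithin O ω ∧ edges G₀ ⊆ O ∧ ¬ Filled O ω Set.univ Set.univ} ⊆
      (⋂ o ∈ J, (N o)ᶜ) ∪ ⋃ o ∈ J, N o ∩ Bad o := by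
    rintro ω ⟨O, hO, hGO, hnot⟩
    by_contra hcon
    simp only [Set.mem_union, Set.mem_iInter, Set.mem_compl_iff, Set.mem_iUnion, Set.mem_inter_iff,
      not_or, not_forall, not_not, not_exists, not_and] at hcon
    obtain ⟨⟨o, ho, hNo⟩, hgood⟩ := hcon
    obtain ⟨h1, h2, -, -⟩ := hB o (hJI ho)
    exact hnot (hfill o ho ω (hgood o ho hNo) O hO hGO
      ((starIn_of_starEdges_subset h1 hNo).filled hO hGO (hF _ h2) h1))
  have hno : μ.real (⋂ o ∈ J, (N o)ᶜ) ≤ Real.exp (-g) := by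
    rw [hμ.real_biInter J (fun o => (N o)ᶜ) (fun o => starEdges (B o) o)]
    · calc ∏ o ∈ J, μ.real (N o)ᶜ ≤ ∏ o ∈ J, Real.exp (-μ.real (N o)) := by
            refine Finset.prod_le_prod (fun _ _ => measureReal_nonneg) fun o _ => ?_
            rw [probReal_compl_eq_one_sub .of_discrete]
            linarith [Real.add_one_le_exp (-μ.real (N o))]
        _ = Real.exp (-∑ o ∈ J, μ.real (N o)) := by
            rw [← Real.exp_sum, Finset.sum_neg_distrib]
        _ ≤ _ := Real.exp_le_exp.2 (by linarith)
    · exact fun o _ => DeterminedBy.compl fun ω ω' h => forall₂_congr h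
    · exact fun o ho o' ho' hne => disjoint_starEdges hne (hdisj o (hJI ho) o' (hJI ho'))
  have hsome : μ.real (⋃ o ∈ J, N o ∩ Bad o) ≤ (g + 1) * δ := by
    have hδ0 : 0 ≤ δ := (Finset.sum_nonneg fun _ _ => by positivity).trans hδ
    calc μ.real (⋃ o ∈ J, N o ∩ Bad o) ≤ ∑ o ∈ J, μ.real (N o ∩ Bad o) :=
          measureReal_biUnion_finset_le _ _
      _ ≤ ∑ o ∈ J, μ.real (N o) * δ := Finset.sum_le_sum fun o ho =>
          (hμ.real_superset_inter_le _ (hlow o ho)).trans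
            (mul_le_mul_of_nonneg_left (hprob o ho) measureReal_nonneg)
      _ = (∑ o ∈ J, μ.real (N o)) * δ := (Finset.sum_mul _ _ _).symm
      _ ≤ (g + 1) * δ := mul_le_mul_of_nonneg_right hJg hδ0
  exact (measureReal_mono hsub (measure_ne_top _ _)).trans
    ((measureReal_union_le _ _).trans (add_le_add hno hsome))

end Nucleation

/-! ### Choice of parameters and limits -/

section Asymptotics

/-- Half of the exponential absorbs k² at the cost 16/c²; the other half is geometric with 1 - r ≥
c/4. -/
lemma sum_sq_mul_exp_le {c : ℝ} (hc0 : 0 < c) (hc1 : c ≤ 1) (m n : ℕ) :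
    ∑ k ∈ Finset.Ico m n, (k : ℝ) ^ 2 * Real.exp (-(c * k)) ≤
      64 / c ^ 3 * Real.exp (-(c * m / 2)) := by
  set r := Real.exp (-(c / 2)) with hr
  have hr0 : 0 ≤ r := (Real.exp_pos _).le
  have hrc : r ≤ 1 - c / 4 := by
    have h1 : r ≤ 1 / (1 + c / 2) := by
      rw [hr, Real.exp_neg, ← one_div]
      exact one_div_le_one_div_of_le (by positivity) (by linarith [Real.add_one_le_exp (c / 2)])
    refine h1.trans ?_
    rw [div_le_iff₀ (by positivity)]
    nlinarith
  have hpow : ∀ k : ℕ, r ^ k = Real.exp (-(c * k / 2)) := fun k => by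
    rw [hr, ← Real.exp_nat_mul]
    congr 1
    ring
  calc ∑ k ∈ Finset.Ico m n, (k : ℝ) ^ 2 * Real.exp (-(c * k))
      ≤ ∑ k ∈ Finset.Ico m n, 16 / c ^ 2 * r ^ k := by
        refine Finset.sum_le_sum fun k _ => ?_
        have h1 : c * k / 4 ≤ Real.exp (c * k / 4) := by
          linarith [Real.add_one_le_exp (c * k / 4)]
        have h2 : (c * k / 4) ^ 2 ≤ Real.exp (c * k / 2) := by
          calc (c * k / 4) ^ 2 ≤ Real.exp (c * k / 4) ^ 2 := by gcongr
            _ = Real.exp (c * k / 2) := by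
              rw [← Real.exp_nat_mul]
              congr 1
              push_cast
              ring
        have h3 : (k : ℝ) ^ 2 ≤ 16 / c ^ 2 * Real.exp (c * k / 2) := by
          calc (k : ℝ) ^ 2 = 16 / c ^ 2 * (c * k / 4) ^ 2 := by
                field_simp
                norm_num
            _ ≤ _ := by gcongr
        calc (k : ℝ) ^ 2 * Real.exp (-(c * k))
            ≤ 16 / c ^ 2 * Real.exp (c * k / 2) * Real.exp (-(c * k)) := by gcongr
          _ = 16 / c ^ 2 * r ^ k := by
            rw [mul_assoc, ← Real.exp_add, hpow]
            congr 2
            ring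
    _ = 16 / c ^ 2 * ∑ k ∈ Finset.Ico m n, r ^ k := (Finset.mul_sum _ _ _).symm
    _ ≤ 16 / c ^ 2 * (r ^ m / (1 - r)) := by
        gcongr
        exact geom_sum_Ico_le_of_lt_one hr0 (by linarith)
    _ ≤ 16 / c ^ 2 * (r ^ m / (c / 4)) := by
        gcongr
        linarith
    _ = 64 / c ^ 3 * Real.exp (-(c * m / 2)) := by
        rw [← hpow]
        field_simp
        ring

/-- The bound for the failure probability when the number of vertices is `exp X`. -/
lemma IsRUnoriented.real_not_filled_le_of_large {V : Type*} [Finite V] {μ : Measure (Set (V × V))}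
    [IsProbabilityMeasure μ] (hμ : IndepBits μ) {X : ℝ} (hV : (Nat.card V : ℝ) = Real.exp X)
    {G₀ : Digraph V} {R : ℕ} (hG₀ : IsRUnoriented R G₀) (hR : 1 ≤ R)
    (hX1 : ((R : ℝ) + 4) ^ 2 ≤ X) (hl : 1 ≤ Real.log X) (hlX : 36 * R * Real.log X ≤ √X)
    (hq : ∀ a b, a ≠ b → 36 * R * Real.log X / √X ≤ μ.real {ω | (a, b) ∈ ω}) :
    μ.real {ω | ∃ O, TransitiveWithin O ω ∧ edges G₀ ⊆ O ∧ ¬ Filled O ω Set.univ Set.univ} ≤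
      Real.exp (-X) + (X + 1) * (14680064 * R / X ^ 2) := by
  have hR' : (1 : ℝ) ≤ R := by exact_mod_cast hR
  have hX25 : 25 ≤ X := by
    have : (5 : ℝ) ^ 2 ≤ ((R : ℝ) + 4) ^ 2 := pow_le_pow_left₀ (by norm_num) (by linarith) 2
    linarith
  have hXR : 8 * R ≤ X := by linarith [sq_nonneg (R : ℝ)]
  have hX0 : 0 < X := by linarith
  set l := Real.log X with hldef
  have hexpl : Real.exp l = X := Real.exp_log hX0
  set s := √X with hs
  have hss : s * s = X := Real.mul_self_sqrt hX0.le
  have hs5 : (R : ℝ) + 4 ≤ s := Real.le_sqrt_of_sq_le hX1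
  have hs0 : 0 < s := by linarith
  set q := 36 * R * l / s with hqdef
  have hsX : s ≤ X := by
    rw [← hss]
    exact le_mul_of_one_le_left hs0.le (by linarith)
  have hRl : 1 ≤ R * l := one_le_mul_of_one_le_of_one_le hR' hl
  have hlR : l ≤ R * l := le_mul_of_one_le_left (by linarith) hR'
  have hq0 : 0 < q := by positivity
  have hq1 : q ≤ 1 := (div_le_one hs0).2 hlX
  have hqs : s⁻¹ ≤ q := by
    rw [hqdef, inv_eq_one_div]
    gcongr
    linarith
  have hq2 : q ^ 2 * X = 1296 * R ^ 2 * l ^ 2 := by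
    rw [hqdef, ← hss]
    field_simp
    norm_num
  -- Small enough that X^(-Rz) = exp(-X/8), so stars are affordable; large enough that q²z = 162Rl,
  -- so growth succeeds.
  set z := X / (8 * R * l) with hz
  have hz0 : 0 < z := by positivity
  have hzX : z * (R * l) = X / 8 := by
    rw [hz]
    field_simp
  set m := ⌈z⌉₊ with hm
  have hzm : z ≤ m := Nat.le_ceil z
  have hmz : (m : ℝ) ≤ z + 1 := (Nat.ceil_lt_add_one hz0.le).le
  have hsz : s ≤ z := by
    rw [hz, le_div_iff₀ (by positivity), ← hss]
    have : s * (8 * R * l) ≤ s * s := by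
      refine mul_le_mul_of_nonneg_left ?_ hs0.le
      linarith
    exact this
  have hRm : R ≤ m := by
    have : (R : ℝ) ≤ m := by linarith
    exact_mod_cast this
  have hm4 : 4 ≤ m := by
    have : (4 : ℝ) ≤ m := by linarith
    exact_mod_cast this
  have hq2m : 160 * l ≤ q ^ 2 * m := by
    have h1 : q ^ 2 * z = 162 * R * l := by
      have h2 : q ^ 2 * z * (8 * R * l) = 162 * R * l * (8 * R * l) := by
        calc q ^ 2 * z * (8 * R * l) = 8 * q ^ 2 * (z * (R * l)) := by ring
          _ = q ^ 2 * X := by rw [hzX]; ring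
          _ = _ := by rw [hq2]; ring
      exact mul_right_cancel₀ (by positivity) h2
    have h3 : q ^ 2 * z ≤ q ^ 2 * m := by gcongr
    linarith
  -- Here 160 = 32 · 5. The fifth power outweighs the factor X³ from the sum and the factor X + 1
  -- from the number of stars.
  have hexp5 : X ^ 5 ≤ Real.exp (q ^ 2 * m / 32) := by
    rw [← hexpl, ← Real.exp_nat_mul]
    refine Real.exp_le_exp.2 ?_
    push_cast
    linarith
  have hlarge : 4 / q ≤ Real.exp (q ^ 2 * m / 32) := by
    refine le_trans ?_ hexp5
    rw [div_le_iff₀ hq0]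
    have h1 : 4 ≤ X ^ 5 * s⁻¹ := by
      rw [← div_eq_mul_inv, le_div_iff₀ hs0]
      have h4 : 4 * s ≤ X ^ 2 := by
        rw [pow_two]
        exact mul_le_mul (by linarith) hsX hs0.le hX0.le
      exact h4.trans (pow_le_pow_right₀ (by linarith) (by norm_num))
    exact h1.trans (by gcongr)
  refine hG₀.real_not_filled_le hμ hq0 hq1 hq hR hRm hm4 hlarge hX0.le ?_ ?_
  -- At least exp(X/2) centres, each with a complete star with probability at least exp(-X/4), give
  -- a mean of at least exp(X/4) ≥ X.
  · have hpow : Real.exp (-(X / 4)) ≤ q ^ (2 * (R * m)) := by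
      have h1 : Real.exp (-(l * (R * m))) = s⁻¹ ^ (2 * (R * m)) := by
        rw [pow_mul, inv_pow, pow_two, hss, ← hexpl, ← Real.exp_neg, ← Real.exp_nat_mul]
        congr 1
        push_cast
        ring
      refine le_trans ?_ (pow_le_pow_left₀ (by positivity) hqs _)
      rw [← h1]
      refine Real.exp_le_exp.2 ?_
      have h2 : l * (R * m) ≤ X / 8 + R * l := by
        calc l * (R * m) = m * (R * l) := by ring
          _ ≤ (z + 1) * (R * l) := by gcongr
          _ = _ := by rw [add_mul, hzX, one_mul]
      have h3 : 36 * (R * l) ≤ X := by linarith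
      linarith
    have hmain : Real.exp (X / 2) ≤ (Nat.card V : ℝ) / R - m := by
      have h1 : (m : ℝ) ≤ 2 * Real.exp (X / 2) := by
        have h2 : z ≤ X := div_le_self hX0.le (by linarith)
        linarith [Real.add_one_le_exp (X / 2)]
      have h3 : 3 * Real.exp (X / 2) ≤ (Nat.card V : ℝ) / R := by
        rw [hV, le_div_iff₀ (by linarith)]
        have h4 : Real.exp X = Real.exp (X / 2) * Real.exp (X / 2) := by
          rw [← Real.exp_add]
          congr 1
          ring
        have h5 : 3 * (R : ℝ) ≤ Real.exp (X / 2) := by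
          linarith [Real.add_one_le_exp (X / 2)]
        rw [h4, mul_assoc, mul_left_comm]
        exact mul_le_mul_of_nonneg_left h5 (Real.exp_pos _).le
      linarith
    calc X ≤ Real.exp (X / 4) := by
          have := Real.quadratic_le_exp_of_nonneg (show 0 ≤ X / 4 by positivity)
          have := mul_le_mul_of_nonneg_right hX25 hX0.le
          linarith
      _ = Real.exp (X / 2) * Real.exp (-(X / 4)) := by
          rw [← Real.exp_add]
          congr 1
          ring
      _ ≤ _ := mul_le_mul hmain hpow (Real.exp_pos _).le ((Real.exp_pos _).le.trans hmain)
  · have h1 := sum_sq_mul_exp_le (c := q ^ 2 / 16) (by positivity)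
      (by linarith [pow_le_one₀ (n := 2) hq0.le hq1]) m (Nat.card V)
    have h2 : ∑ k ∈ Finset.Ico m (Nat.card V), 56 * R * (k : ℝ) ^ 2 * Real.exp (-(q ^ 2 * k / 16)) =
        56 * R * ∑ k ∈ Finset.Ico m (Nat.card V), (k : ℝ) ^ 2 * Real.exp (-(q ^ 2 / 16 * k)) := by
      rw [Finset.mul_sum]
      refine Finset.sum_congr rfl fun k _ => ?_
      rw [mul_assoc (56 * (R : ℝ))]
      congr 4
      ring
    rw [h2]
    have h3 : Real.exp (-(q ^ 2 / 16 * m / 2)) ≤ (X ^ 5)⁻¹ := by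
      rw [Real.exp_neg]
      refine inv_anti₀ (by positivity) (hexp5.trans (le_of_eq ?_))
      congr 1
      ring
    have h4 : 64 / (q ^ 2 / 16) ^ 3 ≤ 262144 * X ^ 3 := by
      have h5 : 1 ≤ q ^ 2 * X := by
        rw [hq2]
        have : 1 ≤ (R * l) ^ 2 := one_le_pow₀ hRl
        linarith
      have h6 : 1 ≤ (q ^ 2 * X) ^ 3 := one_le_pow₀ h5
      rw [div_le_iff₀ (by positivity)]
      calc (64 : ℝ) ≤ 64 * (q ^ 2 * X) ^ 3 := by linarith
        _ = _ := by ring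
    calc _ ≤ 56 * R * (262144 * X ^ 3 * (X ^ 5)⁻¹) := by
          refine mul_le_mul_of_nonneg_left (h1.trans ?_) (by positivity)
          gcongr
      _ = 14680064 * R / X ^ 2 := by
          field_simp
          norm_num

/-- Adjoining the initial edges to the open ones makes them bits of probability 1, so independence
persists and every non-loop edge has probability at least q. -/
lemma le_openLaw_real_isSaturated {V : Type*} [Finite V] (G₀ : Digraph V) (p : unitInterval)
    {q δ : ℝ} (hqp : q ≤ p)
    (h : ∀ μ : Measure (Set (V × V)), IsProbabilityMeasure μ → IndepBits μ →
      (∀ a b, a ≠ b → q ≤ μ.real {ω | (a, b) ∈ ω}) →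
      μ.real {ω | ∃ O, TransitiveWithin O ω ∧ edges G₀ ⊆ O ∧ ¬ Filled O ω Set.univ Set.univ} ≤ δ) :
    1 - δ ≤ (openLaw G₀ p).real {E | IsSaturated G₀ E Set.univ} := by
  have hmeas : Measurable (fun E : Set (V × V) => edges G₀ ∪ E) := .of_discrete
  have hprob : IsProbabilityMeasure (openLaw G₀ p) := by
    unfold openLaw
    infer_instance
  have hδ := h ((openLaw G₀ p).map fun E => edges G₀ ∪ E)
    (Measure.isProbabilityMeasure_map hmeas.aemeasurable)
    ((indepBits_setBernoulli (candidateEdges G₀) p).map Function.injective_id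
      fun ω ω' e he => or_congr Iff.rfl he) ?_
  · rw [map_measureReal_apply hmeas .of_discrete] at hδ
    have hnull : (openLaw G₀ p).real {E | ¬ E ⊆ candidateEdges G₀} = 0 := by
      rw [measureReal_def, show (openLaw G₀ p) {E | ¬ E ⊆ candidateEdges G₀} = 0 from
        setBernoulli_ae_subset, ENNReal.toReal_zero]
    have hsub : {E | IsSaturated G₀ E Set.univ}ᶜ ⊆ (fun E : Set (V × V) => edges G₀ ∪ E) ⁻¹'
        {ω | ∃ O, TransitiveWithin O ω ∧ edges G₀ ⊆ O ∧ ¬ Filled O ω Set.univ Set.univ} ∪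
        {E | ¬ E ⊆ candidateEdges G₀} := by
      intro E hE
      by_cases hEc : E ⊆ candidateEdges G₀
      · exact Or.inl ⟨_, transitiveWithin_eventuallyOccupied G₀ hEc,
          edges_subset_eventuallyOccupied G₀ E, fun hf => hE (isSaturated_of_filled hf)⟩
      · exact Or.inr hEc
    have h1 := (measureReal_mono hsub (measure_ne_top (openLaw G₀ p) _)).trans
      (measureReal_union_le _ _)
    rw [probReal_compl_eq_one_sub .of_discrete] at h1
    linarith
  · intro a b hab
    rw [map_measureReal_apply hmeas .of_discrete]
    by_cases he : (a, b) ∈ edges G₀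
    · have : (fun E : Set (V × V) => edges G₀ ∪ E) ⁻¹' {ω | (a, b) ∈ ω} = Set.univ :=
        Set.eq_univ_of_forall fun E => Or.inl he
      rw [this, probReal_univ]
      exact hqp.trans p.2.2
    · refine hqp.trans ((setBernoulli_real_mem p (u := candidateEdges G₀) (e := (a, b))
        ⟨hab, he⟩).symm.le.trans ?_)
      exact measureReal_mono (fun E hE => Or.inr hE) (measure_ne_top _ _)

lemma eventually_mul_log_le_sqrt (K : ℝ) : ∀ᶠ X : ℝ in atTop, K * Real.log X ≤ √X := by
  have h := ((isLittleO_log_rpow_atTop (show (0 : ℝ) < 1 / 2 by norm_num)).const_mul_left K).bound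
    one_pos
  filter_upwards [h] with X hX
  rw [one_mul, ← Real.sqrt_eq_rpow, Real.norm_of_nonneg (Real.sqrt_nonneg X)] at hX
  exact (le_abs_self _).trans hX

lemma tendsto_failure_bound (K : ℝ) :
    Tendsto (fun X : ℝ => 1 - (Real.exp (-X) + (X + 1) * (K / X ^ 2))) atTop (𝓝 1) := by
  have h1 : Tendsto (fun X : ℝ => Real.exp (-X)) atTop (𝓝 0) :=
    Real.tendsto_exp_neg_atTop_nhds_zero
  have h2 : Tendsto (fun X : ℝ => X⁻¹) atTop (𝓝 0) := tendsto_inv_atTop_zero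
  have h3 : Tendsto (fun X : ℝ => 1 - (Real.exp (-X) + K * (X⁻¹ + X⁻¹ * X⁻¹))) atTop
      (𝓝 (1 - (0 + K * (0 + 0 * 0)))) :=
    (h1.add ((h2.add (h2.mul h2)).const_mul K)).const_sub 1
  have h4 : (1 : ℝ) - (0 + K * (0 + 0 * 0)) = 1 := by ring
  rw [h4] at h3
  refine h3.congr' ?_
  filter_upwards [eventually_ne_atTop 0] with X hX
  field_simp

end Asymptotics

end TransClosure

theorem mainTheorem6 :
    ∀ R : ℕ, 1 ≤ R → ∃ C₀ : ℝ, ∀ C : ℝ, C₀ ≤ C →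
      ∀ (G₀ : (n : ℕ) → Digraph (Fin n)) (p : ℕ → unitInterval),
        (∀ᶠ n : ℕ in atTop, TransClosure.IsRUnoriented R (G₀ n)) →
        (∀ᶠ n : ℕ in atTop,
          C * Real.log (Real.log (n : ℝ)) / Real.sqrt (Real.log (n : ℝ)) ≤ (p n : ℝ)) →
        Tendsto
          (fun n : ℕ => (TransClosure.openLaw (G₀ n) (p n)).real
            {Eopen | TransClosure.IsSaturated (G₀ n) Eopen Set.univ})
          atTop (𝓝 1) := by
  intro R hR
  -- With 36R, 36²/8 = 162 exceeds the required 160; larger C is harmless, as only a lower bound on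
  -- the edge probabilities enters.
  refine ⟨36 * R, fun C hC G₀ p hG₀ hp => ?_⟩
  have hlog : Tendsto (fun n : ℕ => Real.log (n : ℝ)) atTop atTop :=
    Real.tendsto_log_atTop.comp tendsto_natCast_atTop_atTop
  refine tendsto_of_tendsto_of_tendsto_of_le_of_le'
    ((TransClosure.tendsto_failure_bound (14680064 * R)).comp hlog) tendsto_const_nhds ?_
    (Eventually.of_forall fun n => ?_)
  · filter_upwards [hG₀, hp, hlog.eventually (eventually_ge_atTop (((R : ℝ) + 4) ^ 2)),
      (Real.tendsto_log_atTop.comp hlog).eventually (eventually_ge_atTop 1),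
      hlog.eventually (TransClosure.eventually_mul_log_le_sqrt (36 * R)),
      eventually_gt_atTop 0] with n hGn hpn h1 h2 h3 hn
    refine TransClosure.le_openLaw_real_isSaturated (G₀ n) (p n)
      (q := 36 * R * Real.log (Real.log n) / √(Real.log n)) (le_trans ?_ hpn) ?_
    · simp only [Function.comp_apply] at h2
      gcongr
    · intro μ _ hμ hq
      refine hGn.real_not_filled_le_of_large hμ ?_ hR h1 h2 h3 hq
      rw [Nat.card_fin, Real.exp_log (by exact_mod_cast hn)]
  · have : IsProbabilityMeasure (TransClosure.openLaw (G₀ n) (p n)) := by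
      unfold TransClosure.openLaw
      infer_instance
    exact measureReal_le_one
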